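/- Let $d=3$ or let $d\ge 2$ be even. Then there exist a vector field $u\in C_c^\infty(\mathbb{R}^d;\mathbb{R}^d)$ with $u\not\equiv 0$ and a function $p\in C_c^\infty(\mathbb{R}^d)$ that solve the stationary incompressible Euler equations on $\mathbb{R}^d$, $$(u\cdot\nabla)u+\nabla p=0,\qquad \operatorname{div}u=0 .$$ Moreover, if $d\ge 2$ is even, then for every even function $f\in C_c^\infty(\mathbb{R})$ the vector field $$u(x)=f(|x|)\,(x_2,-x_1,x_4,-x_3,\dots,x_d,-x_{d-1})$$ is $C^\infty$ and compactly supported on $\mathbb{R}^d$, the function $$p(x)=\int_0^{|x|} r\,f(r)^2\,dr$$ is $C^\infty$ on $\mathbb{R}^d$, the pair $(u,p)$ solves the stationary Euler equations above, and $u\not\equiv 0$ whenever $f\not\equiv 0$. -/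

import Mathlib

open scoped ContDiff

noncomputable section

/-- The divergence `∑ i, ∂ u_i / ∂ x_i` of a vector field on `ℝ^d`. -/
def divergence {d : ℕ} (u : EuclideanSpace ℝ (Fin d) → EuclideanSpace ℝ (Fin d))
    (x : EuclideanSpace ℝ (Fin d)) : ℝ :=
  ∑ i, fderiv ℝ u x (EuclideanSpace.single i 1) i

/-- The advection term `(u · ∇) u`: the `i`-th component at `x` is `∑ j, u_j ∂ u_i / ∂ x_j`, that is,
the derivative of `u` at `x` in the direction `u x`. -/
def advection {d : ℕ} (u : EuclideanSpace ℝ (Fin d) → EuclideanSpace ℝ (Fin d))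
    (x : EuclideanSpace ℝ (Fin d)) : EuclideanSpace ℝ (Fin d) :=
  fderiv ℝ u x (u x)

/-- `(u, p)` is a smooth solution of the stationary incompressible Euler equations
`(u · ∇) u + ∇ p = 0`, `div u = 0` on `ℝ^d`. -/
structure IsStationaryEuler {d : ℕ} (u : EuclideanSpace ℝ (Fin d) → EuclideanSpace ℝ (Fin d))
    (p : EuclideanSpace ℝ (Fin d) → ℝ) : Prop where
  smooth_velocity : ContDiff ℝ ∞ u
  smooth_pressure : ContDiff ℝ ∞ p
  momentum : ∀ x, advection u x + gradient p x = 0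
  div_free : ∀ x, divergence u x = 0

/-- For even `d`, the linear field `(x₂, -x₁, x₄, -x₃, …, x_d, -x_{d-1})` on `ℝ^d`
(the coordinates of `Fin d` are numbered from `0`). -/
def rotationField {d : ℕ} (hd : Even d) (x : EuclideanSpace ℝ (Fin d)) :
    EuclideanSpace ℝ (Fin d) :=
  WithLp.toLp 2 fun i : Fin d =>
    if h : Even (i : ℕ) then x ⟨(i : ℕ) + 1, by grind⟩ else -x ⟨(i : ℕ) - 1, by omega⟩

/-- The velocity field `f(|x|) (x₂, -x₁, …, x_d, -x_{d-1})`. -/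
def radialVelocity {d : ℕ} (hd : Even d) (f : ℝ → ℝ) (x : EuclideanSpace ℝ (Fin d)) :
    EuclideanSpace ℝ (Fin d) :=
  f ‖x‖ • rotationField hd x

/-- The pressure `∫₀^{|x|} r f(r)² dr`. -/
def radialPressure {d : ℕ} (f : ℝ → ℝ) (x : EuclideanSpace ℝ (Fin d)) : ℝ :=
  ∫ r in (0 : ℝ)..‖x‖, r * f r ^ 2

end

/-!
If `u` solves the stationary Euler equations with a pressure `ψ` that is constant along the
trajectories of `u`, then for every `χ` so does `χ(ψ) u`, with a pressure whose gradient is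
`χ(ψ)² ∇ψ`. It therefore suffices to find a flow of this kind in an open set where `ψ` has a compact
sublevel set, and to choose `χ` supported in a range of levels. In even dimensions
`u = (x₂, -x₁, …)` and `ψ = |x|² / 2` will do.

For `d = 3` the flow is axisymmetric with swirl, and its pressure `ψ` is also its stream function in
the coordinates `ρ = r² / 2` and `z`. The axial momentum equation then says that `∂ψ/∂ρ = ρ + k(ψ)`,
and imposing `|u|² = 3ψ` gives `(∂ψ/∂z)² = 2ρ (3ψ - (ρ + k(ψ))²) - W(ψ)`, where `W` is the squared
angular momentum. The radial momentum equation and the compatibility of these two are a system of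
ordinary differential equations for `k` and `W`, singular at the level `0`; it is solved by a power
series whose coefficients obey a weighted Catalan recursion. The square root in `∂ψ/∂z` is singular
at the minimum of `ψ`, a point off the axis, which is remedied by the hodograph transformation: `ψ`
and `z` are smooth functions of `ρ` and `v = ∂ψ/∂z`.
-/

noncomputable section

open Filter Function InnerProductSpace MeasureTheory Set Topology

section StationaryEuler

variable {d : ℕ} {u v : EuclideanSpace ℝ (Fin d) → EuclideanSpace ℝ (Fin d)}
  {p q ψ g : EuclideanSpace ℝ (Fin d) → ℝ} {x : EuclideanSpace ℝ (Fin d)}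

/-- `(u, p)` is smooth at `x` and satisfies the stationary Euler equations at the point `x`. -/
structure IsStationaryEulerAt (u : EuclideanSpace ℝ (Fin d) → EuclideanSpace ℝ (Fin d))
    (p : EuclideanSpace ℝ (Fin d) → ℝ) (x : EuclideanSpace ℝ (Fin d)) : Prop where
  smooth_velocity : ContDiffAt ℝ ∞ u x
  smooth_pressure : ContDiffAt ℝ ∞ p x
  momentum : advection u x + gradient p x = 0
  div_free : divergence u x = 0

/-- There is a nonzero smooth stationary Euler flow on `ℝ^d` whose velocity and pressure are both
compactly supported. -/
def ExistsCompactEulerFlow (d : ℕ) : Prop :=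
  ∃ (u : EuclideanSpace ℝ (Fin d) → EuclideanSpace ℝ (Fin d)) (p : EuclideanSpace ℝ (Fin d) → ℝ),
    IsStationaryEuler u p ∧ HasCompactSupport u ∧ HasCompactSupport p ∧ u ≠ 0

theorem isStationaryEuler_of_forall_at (h : ∀ x, IsStationaryEulerAt u p x) :
    IsStationaryEuler u p where
  smooth_velocity := contDiff_iff_contDiffAt.2 fun x => (h x).smooth_velocity
  smooth_pressure := contDiff_iff_contDiffAt.2 fun x => (h x).smooth_pressure
  momentum x := (h x).momentum
  div_free x := (h x).div_free

theorem IsStationaryEulerAt.congr_of_eventuallyEq (h : IsStationaryEulerAt u p x)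
    (hv : v =ᶠ[𝓝 x] u) (hq : q =ᶠ[𝓝 x] p) : IsStationaryEulerAt v q x where
  smooth_velocity := h.smooth_velocity.congr_of_eventuallyEq hv
  smooth_pressure := h.smooth_pressure.congr_of_eventuallyEq hq
  momentum := by
    rw [advection, hv.fderiv_eq, hv.self_of_nhds, hq.gradient_eq]
    exact h.momentum
  div_free := by
    rw [divergence, hv.fderiv_eq]
    exact h.div_free

theorem isStationaryEulerAt_zero (hp : ContDiffAt ℝ ∞ p x) (hgrad : gradient p x = 0) :
    IsStationaryEulerAt 0 p x where
  smooth_velocity := contDiffAt_const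
  smooth_pressure := hp
  momentum := by simp [advection, hgrad]
  div_free := by simp [divergence]

theorem divergence_smul (hg : DifferentiableAt ℝ g x) (hu : DifferentiableAt ℝ u x) :
    divergence (g • u) x = g x * divergence u x + fderiv ℝ g x (u x) := by
  have expand : fderiv ℝ g x (u x) = ∑ i, fderiv ℝ g x (EuclideanSpace.single i 1) * u x i := by
    conv_lhs => rw [← (EuclideanSpace.basisFun (Fin d) ℝ).sum_repr (u x)]
    simp [mul_comm]
  simp [divergence, fderiv_smul hg hu, expand, Finset.mul_sum, Finset.sum_add_distrib]

theorem advection_smul (hg : DifferentiableAt ℝ g x) (hu : DifferentiableAt ℝ u x) :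
    advection (g • u) x = g x ^ 2 • advection u x + (g x * fderiv ℝ g x (u x)) • u x := by
  simp [advection, fderiv_smul hg hu, smul_smul, sq]

theorem hasGradientAt_comp {E : Type*} [NormedAddCommGroup E] [InnerProductSpace ℝ E]
    [CompleteSpace E] {Q : ℝ → ℝ} {Q' : ℝ} {f : E → ℝ} {x : E}
    (hQ : HasDerivAt Q Q' (f x)) (hf : DifferentiableAt ℝ f x) :
    HasGradientAt (Q ∘ f) (Q' • gradient f x) x := by
  rw [hasGradientAt_iff_hasFDerivAt, map_smul, toDual_gradient]
  exact hQ.comp_hasFDerivAt x hf.hasFDerivAt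

theorem IsStationaryEulerAt.smul (h : IsStationaryEulerAt u p x) (hg : ContDiffAt ℝ ∞ g x)
    (htan : fderiv ℝ g x (u x) = 0) (hq : ContDiffAt ℝ ∞ q x)
    (hgrad : gradient q x = g x ^ 2 • gradient p x) : IsStationaryEulerAt (g • u) q x := by
  have hgd := hg.differentiableAt (by simp)
  have hud := h.smooth_velocity.differentiableAt (by simp)
  refine ⟨hg.smul h.smooth_velocity, hq, ?_, ?_⟩
  · rw [advection_smul hgd hud, htan, hgrad, mul_zero, zero_smul, add_zero, ← smul_add,
      h.momentum, smul_zero]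
  · rw [divergence_smul hgd hud, htan, h.div_free, mul_zero, add_zero]

theorem hasDerivAt_primitive {f : ℝ → ℝ} (hf : Continuous f) (a s : ℝ) :
    HasDerivAt (fun s => ∫ t in a..s, f t) (f s) s :=
  (hf.integral_hasStrictDerivAt a s).hasDerivAt

theorem contDiff_primitive {f : ℝ → ℝ} (hf : ContDiff ℝ ∞ f) (a : ℝ) :
    ContDiff ℝ ∞ fun s => ∫ t in a..s, f t := by
  refine contDiff_infty_iff_deriv.2
    ⟨fun s => (hasDerivAt_primitive hf.continuous a s).differentiableAt, ?_⟩
  rwa [funext fun s => (hasDerivAt_primitive hf.continuous a s).deriv]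

theorem IsStationaryEulerAt.comp_pressure (h : IsStationaryEulerAt u ψ x)
    (htan : fderiv ℝ ψ x (u x) = 0) {χ : ℝ → ℝ} (hχ : ContDiff ℝ ∞ χ) (a : ℝ) :
    IsStationaryEulerAt ((χ ∘ ψ) • u) ((fun s => ∫ t in a..s, χ t ^ 2) ∘ ψ) x := by
  have hψ := h.smooth_pressure.differentiableAt (by simp)
  refine h.smul (hχ.contDiffAt.comp x h.smooth_pressure) ?_
    ((contDiff_primitive (hχ.pow 2) a).contDiffAt.comp x h.smooth_pressure)
    (hasGradientAt_comp (hasDerivAt_primitive (hχ.continuous.pow 2) a _) hψ).gradient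
  rw [((hχ.differentiable (by simp) _).hasDerivAt.comp_hasFDerivAt x hψ.hasFDerivAt).fderiv]
  simp [htan]

theorem isStationaryEulerAt_cutoff (hψ : ContDiffAt ℝ ∞ ψ x) {χ : ℝ → ℝ} (hχ : ContDiff ℝ ∞ χ)
    (hu : ψ x ∈ tsupport χ → IsStationaryEulerAt u ψ x ∧ fderiv ℝ ψ x (u x) = 0) (a : ℝ) :
    IsStationaryEulerAt ((χ ∘ ψ) • u) ((fun s => ∫ t in a..s, χ t ^ 2) ∘ ψ) x := by
  by_cases hs : ψ x ∈ tsupport χ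
  · exact (hu hs).1.comp_pressure (hu hs).2 hχ a
  · have hzero : (χ ∘ ψ) • u =ᶠ[𝓝 x] 0 := by
      filter_upwards [hψ.continuousAt.eventually (notMem_tsupport_iff_eventuallyEq.1 hs)]
        with y hy
      simp [hy]
    have hgrad := (hasGradientAt_comp (hasDerivAt_primitive (hχ.continuous.pow 2) a _)
      (hψ.differentiableAt (by simp))).gradient
    rw [Pi.pow_apply, image_eq_zero_of_notMem_tsupport hs, zero_pow two_ne_zero,
      zero_smul] at hgrad
    exact (isStationaryEulerAt_zero ((contDiff_primitive (hχ.pow 2) a).contDiffAt.comp x hψ)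
      hgrad).congr_of_eventuallyEq hzero .rfl

theorem existsCompactEulerFlow_of_isCompact_sublevel {W : Set (EuclideanSpace ℝ (Fin d))}
    (hW : IsOpen W) {a b : ℝ} (hψ : ContDiffOn ℝ ∞ ψ W)
    (hu : ∀ y ∈ W, ψ y ∈ Ioo a b → IsStationaryEulerAt u ψ y ∧ fderiv ℝ ψ y (u y) = 0)
    (hK : IsCompact {y ∈ W | ψ y ≤ b}) (hxW : x ∈ W) (hx : ψ x ∈ Ioo a b) (hux : u x ≠ 0) :
    ExistsCompactEulerFlow d := by
  classical
  obtain ⟨χ, hχ_supp, -, hχ, -, hχx⟩ :=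
    exists_contDiff_tsupport_subset (n := ⊤) (Ioo_mem_nhds hx.1 hx.2)
  have hχ_zero {s : ℝ} (hs : s ∉ Ioo a b) : χ s = 0 :=
    image_eq_zero_of_notMem_tsupport fun h => hs (hχ_supp h)
  let Q (s : ℝ) : ℝ := ∫ t in b..s, χ t ^ 2
  have hQ_zero {s : ℝ} (hs : b ≤ s) : Q s = 0 := by
    refine intervalIntegral.integral_zero_ae (.of_forall fun t ht => ?_)
    rw [uIoc_of_le hs] at ht
    rw [hχ_zero fun h => h.2.not_gt ht.1, zero_pow two_ne_zero]
  let U := W.indicator ((χ ∘ ψ) • u)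
  let P := W.indicator (Q ∘ ψ)
  have hU_K (y) (hy : y ∉ {y ∈ W | ψ y ≤ b}) : U y = 0 := by
    refine indicator_apply_eq_zero.2 fun hyW => ?_
    simp [hχ_zero fun h => hy ⟨hyW, h.2.le⟩]
  have hP_K (y) (hy : y ∉ {y ∈ W | ψ y ≤ b}) : P y = 0 :=
    indicator_apply_eq_zero.2 fun hyW => hQ_zero (not_le.1 fun h => hy ⟨hyW, h⟩).le
  refine ⟨U, P, isStationaryEuler_of_forall_at fun y => ?_, .intro hK hU_K, .intro hK hP_K,
    fun h => hux ?_⟩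
  · by_cases hy : y ∈ W
    · have hWy := hW.mem_nhds hy
      exact (isStationaryEulerAt_cutoff (hψ.contDiffAt hWy) hχ (fun hs => hu y hy (hχ_supp hs))
        b).congr_of_eventuallyEq (eqOn_indicator.eventuallyEq_of_mem hWy)
          (eqOn_indicator.eventuallyEq_of_mem hWy)
    · have hKc := hK.isClosed.isOpen_compl.mem_nhds fun h : y ∈ {y ∈ W | ψ y ≤ b} => hy h.1
      exact (isStationaryEulerAt_zero contDiffAt_const (gradient_const y 0)).congr_of_eventuallyEq
        (eventuallyEq_of_mem hKc hU_K) (eventuallyEq_of_mem hKc hP_K)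
  · have hU : U x = 0 := congr_fun h x
    simpa [U, hxW, hχx] using hU

end StationaryEuler

section RadialFunctions

variable {F : Type*} [NormedAddCommGroup F] [NormedSpace ℝ F]

/-- The weighted average `∫₀¹ tᵐ g(t r) dt`. The weights make the family closed under
differentiation in `r`. -/
def weightedAverage (m : ℕ) (g : ℝ → F) (r : ℝ) : F :=
  ∫ t in (0 : ℝ)..1, t ^ m • g (t * r)

theorem hasDerivAt_weightedAverage (m : ℕ) {g : ℝ → F} (hg : ContDiff ℝ 1 g) (r : ℝ) :
    HasDerivAt (weightedAverage m g) (weightedAverage (m + 1) (deriv g) r) r := by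
  have hg0 : Continuous g := hg.continuous
  have hg1 : Continuous (deriv g) := hg.continuous_deriv le_rfl
  obtain ⟨C, hC⟩ := (isCompact_closedBall (0 : ℝ) (|r| + 1)).exists_bound_of_continuousOn
    hg1.continuousOn
  refine (intervalIntegral.hasDerivAt_integral_of_dominated_loc_of_deriv_le
    (bound := fun _ => C) (s := Metric.ball r 1) (Metric.ball_mem_nhds r one_pos)
    (F := fun r t => t ^ m • g (t * r)) (F' := fun r t => t ^ (m + 1) • deriv g (t * r))
    (.of_forall fun x => ?_) ?_ ?_ (.of_forall fun t ht x hx => ?_) intervalIntegrable_const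
    (.of_forall fun t _ x _ => ?_)).2
  · exact Continuous.aestronglyMeasurable (by fun_prop)
  · exact Continuous.intervalIntegrable (by fun_prop) _ _
  · exact Continuous.aestronglyMeasurable (by fun_prop)
  · rw [uIoc_of_le zero_le_one] at ht
    have hx_le : |x| ≤ |r| + 1 := by
      rw [Metric.mem_ball, Real.dist_eq] at hx
      linarith [abs_sub_abs_le_abs_sub x r]
    have htx : t * x ∈ Metric.closedBall 0 (|r| + 1) := by
      rw [mem_closedBall_zero_iff, Real.norm_eq_abs, abs_mul, abs_of_pos ht.1]
      exact (mul_le_of_le_one_left (abs_nonneg x) ht.2).trans hx_le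
    rw [norm_smul, norm_pow, Real.norm_of_nonneg ht.1.le]
    exact (mul_le_of_le_one_left (norm_nonneg _) (pow_le_one₀ ht.1.le ht.2)).trans (hC _ htx)
  · have hgx : HasDerivAt g (deriv g (t * x)) (t * x) :=
      (hg.differentiable one_ne_zero _).hasDerivAt
    have htx : HasDerivAt (fun x => t * x) t x := by simpa using (hasDerivAt_id x).const_mul t
    exact ((hgx.scomp x htx).const_smul (t ^ m)).congr_deriv (by rw [smul_smul, pow_succ])

theorem contDiff_weightedAverage {g : ℝ → F} (hg : ContDiff ℝ ∞ g) (m : ℕ) :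
    ContDiff ℝ ∞ (weightedAverage m g) := by
  rw [contDiff_infty]
  intro n
  induction n generalizing m g with
  | zero =>
    exact contDiff_zero.2 (continuous_iff_continuousAt.2 fun r =>
      (hasDerivAt_weightedAverage m (hg.of_le (by exact_mod_cast le_top)) r).continuousAt)
  | succ n ih =>
    have h := hasDerivAt_weightedAverage m (hg.of_le (by exact_mod_cast le_top) : ContDiff ℝ 1 g)
    rw [Nat.cast_add, Nat.cast_one, contDiff_succ_iff_deriv]
    refine ⟨fun r => (h r).differentiableAt, by simp, ?_⟩
    rw [funext fun r => (h r).deriv]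
    exact ih (contDiff_infty_iff_deriv.1 hg).2 (m + 1)

theorem dslope_zero_eq_weightedAverage [CompleteSpace F] {g : ℝ → F} (hg : ContDiff ℝ 1 g) :
    dslope g 0 = weightedAverage 0 (deriv g) := by
  ext r
  rcases eq_or_ne r 0 with rfl | hr
  · simp [weightedAverage]
  · have hint : ∫ t in (0 : ℝ)..r, deriv g t = g r - g 0 :=
      intervalIntegral.integral_deriv_eq_sub (fun x _ => hg.differentiable one_ne_zero x)
        ((hg.continuous_deriv le_rfl).intervalIntegrable _ _)
    simp only [weightedAverage, pow_zero, one_smul]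
    rw [dslope_of_ne _ hr, slope_def_module, intervalIntegral.integral_comp_mul_right _ hr,
      zero_mul, one_mul, hint, sub_zero]

theorem contDiff_dslope_zero [CompleteSpace F] {g : ℝ → F} (hg : ContDiff ℝ ∞ g) :
    ContDiff ℝ ∞ (dslope g 0) := by
  rw [dslope_zero_eq_weightedAverage (hg.of_le (by exact_mod_cast le_top))]
  exact contDiff_weightedAverage (contDiff_infty_iff_deriv.1 hg).2 0

theorem odd_deriv_of_even {f : ℝ → F} (hf : f.Even) : (deriv f).Odd := fun r => by
  rw [← neg_eq_iff_eq_neg, ← deriv_comp_neg, funext hf]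

theorem even_dslope_of_odd {g : ℝ → F} (hg : g.Odd) : (dslope g 0).Even := fun r => by
  rcases eq_or_ne r 0 with rfl | hr
  · rw [neg_zero]
  · have : IsAddTorsionFree F := .of_isTorsionFree ℝ F
    simp [dslope_of_ne _ hr, dslope_of_ne _ (neg_ne_zero.2 hr), slope_def_module, hg.map_zero,
      hg.eq, inv_neg]

theorem smul_dslope_deriv_of_even {f : ℝ → F} (hf : f.Even) (r : ℝ) :
    r • dslope (deriv f) 0 r = deriv f r := by
  have : IsAddTorsionFree F := .of_isTorsionFree ℝ F
  simpa [(odd_deriv_of_even hf).map_zero] using sub_smul_dslope (deriv f) 0 r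

variable {E : Type*} [NormedAddCommGroup E] [InnerProductSpace ℝ E]

theorem hasFDerivAt_norm {x : E} (hx : x ≠ 0) :
    HasFDerivAt (fun y : E => ‖y‖) (‖x‖⁻¹ • innerSL ℝ x) x := by
  have h := (hasStrictFDerivAt_norm_sq x).hasFDerivAt.sqrt (by simpa using hx)
  simp only [Real.sqrt_sq (norm_nonneg _)] at h
  refine h.congr_fderiv (ContinuousLinearMap.ext fun y => ?_)
  simp only [nsmul_eq_mul, smul_apply, smul_eq_mul]
  push_cast
  field_simp

theorem hasFDerivAt_comp_norm {f : ℝ → ℝ} (hf : Differentiable ℝ f) (he : f.Even) (x : E) :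
    HasFDerivAt (fun y : E => f ‖y‖) (dslope (deriv f) 0 ‖x‖ • innerSL ℝ x) x := by
  have hd (r : ℝ) : HasDerivAt f (r * dslope (deriv f) 0 r) r := by
    rw [← smul_eq_mul, smul_dslope_deriv_of_even he]
    exact (hf r).hasDerivAt
  rcases eq_or_ne x 0 with rfl | hx
  · have h0 := hd 0
    rw [zero_mul, hasDerivAt_iff_isLittleO] at h0
    rw [map_zero, smul_zero, hasFDerivAt_iff_isLittleO, ← Asymptotics.isLittleO_norm_right]
    simpa [Function.comp_def] using h0.comp_tendsto (tendsto_norm_zero (E := E))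
  · refine ((hd ‖x‖).comp_hasFDerivAt x (hasFDerivAt_norm hx)).congr_fderiv ?_
    have hne : ‖x‖ ≠ 0 := norm_ne_zero_iff.2 hx
    rw [smul_smul]
    congr 1
    field_simp

theorem contDiff_comp_norm {f : ℝ → ℝ} (hf : ContDiff ℝ ∞ f) (he : f.Even) :
    ContDiff ℝ ∞ fun x : E => f ‖x‖ := by
  rw [contDiff_infty]
  intro n
  induction n generalizing f with
  | zero => exact contDiff_zero.2 (hf.continuous.comp continuous_norm)
  | succ n ih =>
    have h := hasFDerivAt_comp_norm (E := E) (hf.differentiable (by simp)) he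
    rw [Nat.cast_add, Nat.cast_one, contDiff_succ_iff_fderiv]
    refine ⟨fun x => (h x).differentiableAt, by simp, ?_⟩
    rw [funext fun x => (h x).fderiv]
    exact (ih (contDiff_dslope_zero (contDiff_infty_iff_deriv.1 hf).2)
      (even_dslope_of_odd (odd_deriv_of_even he))).smul (innerSL ℝ).contDiff

theorem hasGradientAt_half_norm_sq [CompleteSpace E] (x : E) :
    HasGradientAt (fun y : E => ‖y‖ ^ 2 / 2) x x := by
  rw [hasGradientAt_iff_hasFDerivAt]
  simp only [div_eq_inv_mul]
  refine ((hasStrictFDerivAt_norm_sq x).hasFDerivAt.const_mul 2⁻¹).congr_fderiv ?_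
  ext y
  simp

end RadialFunctions

section EvenDimension

variable {d : ℕ}

theorem isStationaryEulerAt_of_skew {J : EuclideanSpace ℝ (Fin d) →L[ℝ] EuclideanSpace ℝ (Fin d)}
    (hJ : ∀ x, inner ℝ x (J x) = 0) (hJJ : ∀ x, J (J x) = -x) (x : EuclideanSpace ℝ (Fin d)) :
    IsStationaryEulerAt J (fun y => ‖y‖ ^ 2 / 2) x where
  smooth_velocity := J.contDiff.contDiffAt
  smooth_pressure := ((contDiff_norm_sq ℝ).div_const 2).contDiffAt
  momentum := by
    rw [advection, J.fderiv, hJJ, (hasGradientAt_half_norm_sq x).gradient, neg_add_cancel]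
  div_free := by
    rw [divergence, J.fderiv]
    refine Finset.sum_eq_zero fun i _ => ?_
    simpa [EuclideanSpace.inner_single_left] using hJ (EuclideanSpace.single i 1)

variable {f : ℝ → ℝ}

theorem even_primitive_of_odd {g : ℝ → ℝ} (hg : g.Odd) :
    (fun s : ℝ => ∫ r in (0 : ℝ)..s, g r).Even := fun s => by
  have h := intervalIntegral.integral_comp_neg (a := 0) (b := s) g
  simp only [hg.eq, intervalIntegral.integral_neg, neg_zero] at h
  change ∫ r in (0 : ℝ)..-s, g r = ∫ r in (0 : ℝ)..s, g r
  rw [intervalIntegral.integral_symm, ← h, neg_neg]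

theorem odd_mul_sq_of_even (he : f.Even) : (fun r => r * f r ^ 2).Odd := fun r => by
  simp only [he.eq, neg_mul]

theorem contDiff_radialPressure (hf : ContDiff ℝ ∞ f) (he : f.Even) :
    ContDiff ℝ ∞ (radialPressure f : EuclideanSpace ℝ (Fin d) → ℝ) :=
  contDiff_comp_norm (contDiff_primitive (contDiff_id.mul (hf.pow 2)) 0)
    (even_primitive_of_odd (odd_mul_sq_of_even he))

theorem hasGradientAt_radialPressure (hf : Continuous f) (he : f.Even)
    (x : EuclideanSpace ℝ (Fin d)) :
    HasGradientAt (radialPressure f) (f ‖x‖ ^ 2 • x) x := by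
  have hQ (s : ℝ) : HasDerivAt (fun s => ∫ r in (0 : ℝ)..s, r * f r ^ 2) (s * f s ^ 2) s :=
    hasDerivAt_primitive (continuous_id.mul (hf.pow 2)) 0 s
  have heven := even_primitive_of_odd (odd_mul_sq_of_even he)
  rw [hasGradientAt_iff_hasFDerivAt]
  refine (hasFDerivAt_comp_norm (fun s => (hQ s).differentiableAt) heven x).congr_fderiv ?_
  rcases eq_or_ne x 0 with rfl | hx
  · simp
  · have hslope := smul_dslope_deriv_of_even heven ‖x‖
    have hderiv := (hQ ‖x‖).deriv
    rw [smul_right_injective ℝ (norm_ne_zero_iff.2 hx) (hslope.trans hderiv)]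
    ext y
    simp

theorem isStationaryEulerAt_radial {J : EuclideanSpace ℝ (Fin d) →L[ℝ] EuclideanSpace ℝ (Fin d)}
    (hJ : ∀ x, inner ℝ x (J x) = 0) (hJJ : ∀ x, J (J x) = -x) (hf : ContDiff ℝ ∞ f)
    (he : f.Even) (x : EuclideanSpace ℝ (Fin d)) :
    IsStationaryEulerAt (fun y => f ‖y‖ • J y) (radialPressure f) x := by
  refine (isStationaryEulerAt_of_skew hJ hJJ x).smul (contDiff_comp_norm hf he).contDiffAt ?_
    (contDiff_radialPressure hf he).contDiffAt ?_
  · rw [(hasFDerivAt_comp_norm (hf.differentiable (by simp)) he x).fderiv]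
    simp [hJ]
  · rw [(hasGradientAt_radialPressure hf.continuous he x).gradient,
      (hasGradientAt_half_norm_sq x).gradient]

/-- The coordinate that `rotationField` pairs with `i`. -/
def pairedIndex (hd : Even d) (i : Fin d) : Fin d :=
  if h : Even (i : ℕ) then ⟨(i : ℕ) + 1, by grind⟩ else ⟨(i : ℕ) - 1, by omega⟩

theorem rotationField_apply (hd : Even d) (x : EuclideanSpace ℝ (Fin d)) (i : Fin d) :
    rotationField hd x i = (-1) ^ (i : ℕ) * x (pairedIndex hd i) := by
  by_cases h : Even (i : ℕ)
  · simp [rotationField, pairedIndex, h]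
  · simp [rotationField, pairedIndex, h, (Nat.not_even_iff_odd.1 h).neg_one_pow]

theorem even_pairedIndex (hd : Even d) (i : Fin d) :
    Even (pairedIndex hd i : ℕ) ↔ ¬Even (i : ℕ) := by
  unfold pairedIndex
  split_ifs with h
  · simp [Nat.even_add_one, h]
  · grind

theorem pairedIndex_pairedIndex (hd : Even d) (i : Fin d) :
    pairedIndex hd (pairedIndex hd i) = i := by
  have h := even_pairedIndex hd i
  ext
  grind [pairedIndex]

theorem pairedIndex_ne (hd : Even d) (i : Fin d) : pairedIndex hd i ≠ i := fun h => by
  have := even_pairedIndex hd i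
  grind

theorem neg_one_pow_pairedIndex (hd : Even d) (i : Fin d) :
    (-1 : ℝ) ^ (pairedIndex hd i : ℕ) = -(-1) ^ (i : ℕ) := by
  have h := even_pairedIndex hd i
  rcases Nat.even_or_odd (i : ℕ) with hi | hi
  · rw [hi.neg_one_pow, (Nat.not_even_iff_odd.1 fun hp => h.1 hp hi).neg_one_pow]
  · rw [hi.neg_one_pow, (h.2 (Nat.not_even_iff_odd.2 hi)).neg_one_pow, neg_neg]

theorem rotationField_rotationField (hd : Even d) (x : EuclideanSpace ℝ (Fin d)) :
    rotationField hd (rotationField hd x) = -x := by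
  ext i
  rw [rotationField_apply, rotationField_apply, pairedIndex_pairedIndex,
    neg_one_pow_pairedIndex, PiLp.neg_apply, neg_mul, mul_neg, ← mul_assoc, ← mul_pow,
    neg_one_mul, neg_neg, one_pow, one_mul]

theorem inner_rotationField (hd : Even d) (x : EuclideanSpace ℝ (Fin d)) :
    inner ℝ x (rotationField hd x) = 0 := by
  rw [PiLp.inner_apply]
  refine Finset.sum_involution (fun i _ => pairedIndex hd i) (fun i _ => ?_)
    (fun i _ _ => pairedIndex_ne hd i) (fun _ _ => Finset.mem_univ _)
    (fun i _ => pairedIndex_pairedIndex hd i)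
  simp only [rotationField_apply, pairedIndex_pairedIndex, neg_one_pow_pairedIndex,
    RCLike.inner_apply, conj_trivial]
  ring

/-- `rotationField` as a continuous linear map. -/
def rotationCLM (hd : Even d) : EuclideanSpace ℝ (Fin d) →L[ℝ] EuclideanSpace ℝ (Fin d) :=
  LinearMap.toContinuousLinearMap
    { toFun := rotationField hd
      map_add' x y := by
        ext i
        simp only [rotationField_apply, PiLp.add_apply, mul_add]
      map_smul' c x := by
        ext i
        simp only [rotationField_apply, PiLp.smul_apply, smul_eq_mul, RingHom.id_apply,
          mul_left_comm] }

theorem rotationField_ne_zero (hd : Even d) {x : EuclideanSpace ℝ (Fin d)} (hx : x ≠ 0) :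
    rotationField hd x ≠ 0 := fun h => hx <| by
  rw [← neg_eq_zero, ← rotationField_rotationField hd, h]
  exact map_zero (rotationCLM hd)

theorem isStationaryEuler_radial (hd : Even d) (hf : ContDiff ℝ ∞ f) (he : f.Even) :
    IsStationaryEuler (radialVelocity hd f) (radialPressure f) :=
  isStationaryEuler_of_forall_at fun x => isStationaryEulerAt_radial (J := rotationCLM hd)
    (inner_rotationField hd) (rotationField_rotationField hd) hf he x

theorem hasCompactSupport_radialVelocity (hd : Even d) (hf : HasCompactSupport f) :
    HasCompactSupport (radialVelocity hd f) := by
  obtain ⟨R, hR⟩ := hf.isCompact.isBounded.bddAbove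
  refine .intro (isCompact_closedBall (0 : EuclideanSpace ℝ (Fin d)) R) fun x hx => ?_
  rw [mem_closedBall_zero_iff] at hx
  rw [radialVelocity, image_eq_zero_of_notMem_tsupport fun h => hx (hR h), zero_smul]

theorem radialVelocity_ne_zero (hd : Even d) (h2 : 2 ≤ d) (hf : Continuous f) (he : f.Even)
    (h0 : f ≠ 0) : radialVelocity hd f ≠ 0 := fun hu => by
  refine h0 (hf.ext_on (dense_compl_singleton 0) continuous_zero fun r hr => ?_)
  let x : EuclideanSpace ℝ (Fin d) := EuclideanSpace.single ⟨0, by omega⟩ r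
  have hnorm : ‖x‖ = |r| := by simp [x]
  have hx : x ≠ 0 := norm_ne_zero_iff.1 (hnorm ▸ abs_ne_zero.2 hr)
  have hfx : f |r| = 0 := by
    rw [← hnorm]
    exact (smul_eq_zero.1 (congr_fun hu x)).resolve_right (rotationField_ne_zero hd hx)
  rcases abs_choice r with h | h
  · rwa [h] at hfx
  · rwa [h, he] at hfx

theorem existsCompactEulerFlow_of_even (hd : Even d) (h2 : 2 ≤ d) : ExistsCompactEulerFlow d := by
  let x : EuclideanSpace ℝ (Fin d) := EuclideanSpace.single ⟨0, by omega⟩ 1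
  have hK : IsCompact {y ∈ univ | ‖(y : EuclideanSpace ℝ (Fin d))‖ ^ 2 / 2 ≤ 1} := by
    have hclosed : IsClosed {y : EuclideanSpace ℝ (Fin d) | ‖y‖ ^ 2 / 2 ≤ 1} :=
      isClosed_le (by fun_prop) continuous_const
    refine (isCompact_closedBall (0 : EuclideanSpace ℝ (Fin d)) 2).of_isClosed_subset
      (by simpa using hclosed) fun y hy => ?_
    rw [mem_closedBall_zero_iff]
    nlinarith [hy.2]
  refine existsCompactEulerFlow_of_isCompact_sublevel (u := rotationCLM hd) (x := x) (a := 0)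
    isOpen_univ ((contDiff_norm_sq ℝ).div_const 2).contDiffOn
    (fun y _ _ => ⟨isStationaryEulerAt_of_skew (inner_rotationField hd)
      (rotationField_rotationField hd) y, ?_⟩) hK (mem_univ x) ?_
    (rotationField_ne_zero hd ?_)
  · rw [(hasGradientAt_half_norm_sq y).fderiv_apply]
    exact inner_rotationField hd y
  · norm_num [x]
  · simp [x]

end EvenDimension

section Axisymmetric

variable {β γ w q : ℝ × ℝ → ℝ} {x y : EuclideanSpace ℝ (Fin 3)}

/-- The projection to the meridian half-plane, with half the squared distance to the axis of
symmetry as radial coordinate. -/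
def meridian (x : EuclideanSpace ℝ (Fin 3)) : ℝ × ℝ := ((x 0 ^ 2 + x 1 ^ 2) / 2, x 2)

/-- The axisymmetric vector field on `ℝ³` with radial component `r β`, angular component `r γ`
and axial component `w`, where `r` is the distance to the axis and `β`, `γ`, `w` are functions on
the meridian half-plane. -/
def axisymmetricField (β γ w : ℝ × ℝ → ℝ) (x : EuclideanSpace ℝ (Fin 3)) :
    EuclideanSpace ℝ (Fin 3) :=
  !₂[β (meridian x) * x 0 - γ (meridian x) * x 1, β (meridian x) * x 1 + γ (meridian x) * x 0,
    w (meridian x)]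

/-- The image of an axisymmetric vector field under the derivative of `meridian`. -/
def meridianField (β w : ℝ × ℝ → ℝ) (m : ℝ × ℝ) : ℝ × ℝ := (2 * m.1 * β m, w m)

theorem contDiff_meridian : ContDiff ℝ ∞ meridian := by
  unfold meridian
  fun_prop

theorem hasFDerivAt_coord (i : Fin 3) (x : EuclideanSpace ℝ (Fin 3)) :
    HasFDerivAt (fun y : EuclideanSpace ℝ (Fin 3) => y i)
      (EuclideanSpace.proj i : EuclideanSpace ℝ (Fin 3) →L[ℝ] ℝ) x :=
  (EuclideanSpace.proj i : EuclideanSpace ℝ (Fin 3) →L[ℝ] ℝ).hasFDerivAt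

theorem fderiv_coord {u : EuclideanSpace ℝ (Fin 3) → EuclideanSpace ℝ (Fin 3)}
    (hu : DifferentiableAt ℝ u x) (i : Fin 3) :
    fderiv ℝ u x y i = fderiv ℝ (fun z => u z i) x y :=
  (DFunLike.congr_fun ((hasFDerivAt_coord i (u x)).comp x hu.hasFDerivAt).fderiv y).symm

theorem fderiv_meridian_apply (x y : EuclideanSpace ℝ (Fin 3)) :
    fderiv ℝ meridian x y = (x 0 * y 0 + x 1 * y 1, y 2) := by
  have h := ((((hasFDerivAt_coord 0 x).pow 2).add ((hasFDerivAt_coord 1 x).pow 2)).mul_const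
    (2⁻¹ : ℝ)).prodMk (hasFDerivAt_coord 2 x)
  refine (DFunLike.congr_fun h.fderiv y).trans (Prod.ext ?_ rfl)
  simp only [Nat.add_one_sub_one, pow_one, nsmul_eq_mul, Nat.cast_ofNat, smul_add,
    ContinuousLinearMap.prod_apply, add_apply, smul_apply, PiLp.proj_apply, smul_eq_mul]
  ring

theorem hasFDerivAt_comp_meridian (hq : DifferentiableAt ℝ q (meridian x)) :
    HasFDerivAt (q ∘ meridian) (fderiv ℝ q (meridian x) ∘L fderiv ℝ meridian x) x :=
  hq.hasFDerivAt.comp x (contDiff_meridian.differentiable (by simp) x).hasFDerivAt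

theorem contDiffAt_axisymmetricField (hβ : ContDiffAt ℝ ∞ β (meridian x))
    (hγ : ContDiffAt ℝ ∞ γ (meridian x)) (hw : ContDiffAt ℝ ∞ w (meridian x)) :
    ContDiffAt ℝ ∞ (axisymmetricField β γ w) x := by
  have hm := contDiff_meridian.contDiffAt (x := x)
  have hβm := hβ.comp x hm
  have hγm := hγ.comp x hm
  have hcoord (i : Fin 3) : ContDiffAt ℝ ∞ (fun x : EuclideanSpace ℝ (Fin 3) => x i) x := by
    fun_prop
  rw [contDiffAt_euclidean, Fin.forall_fin_succ, Fin.forall_fin_two]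
  exact ⟨(hβm.mul (hcoord 0)).sub (hγm.mul (hcoord 1)),
    (hβm.mul (hcoord 1)).add (hγm.mul (hcoord 0)), hw.comp x hm⟩

theorem differentiableAt_axisymmetricField (hβ : DifferentiableAt ℝ β (meridian x))
    (hγ : DifferentiableAt ℝ γ (meridian x)) (hw : DifferentiableAt ℝ w (meridian x)) :
    DifferentiableAt ℝ (axisymmetricField β γ w) x := by
  have hβm := (hasFDerivAt_comp_meridian hβ).differentiableAt
  have hγm := (hasFDerivAt_comp_meridian hγ).differentiableAt
  have hcoord (i : Fin 3) := (hasFDerivAt_coord i x).differentiableAt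
  rw [differentiableAt_euclidean, Fin.forall_fin_succ, Fin.forall_fin_two]
  exact ⟨(hβm.mul (hcoord 0)).sub (hγm.mul (hcoord 1)),
    (hβm.mul (hcoord 1)).add (hγm.mul (hcoord 0)), (hasFDerivAt_comp_meridian hw).differentiableAt⟩

theorem fderiv_axisymmetricField_apply (hβ : DifferentiableAt ℝ β (meridian x))
    (hγ : DifferentiableAt ℝ γ (meridian x)) (hw : DifferentiableAt ℝ w (meridian x))
    (y : EuclideanSpace ℝ (Fin 3)) :
    fderiv ℝ (axisymmetricField β γ w) x y =
      axisymmetricField (fun _ => β (meridian x)) (fun _ => γ (meridian x)) 0 y +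
      axisymmetricField (fun _ => fderiv ℝ β (meridian x) (fderiv ℝ meridian x y))
        (fun _ => fderiv ℝ γ (meridian x) (fderiv ℝ meridian x y))
        (fun _ => fderiv ℝ w (meridian x) (fderiv ℝ meridian x y)) x := by
  have hβm := hasFDerivAt_comp_meridian hβ
  have hγm := hasFDerivAt_comp_meridian hγ
  have hdiff : DifferentiableAt ℝ (axisymmetricField β γ w) x :=
    differentiableAt_axisymmetricField hβ hγ hw
  ext i
  rw [fderiv_coord hdiff]
  fin_cases i
  · refine (DFunLike.congr_fun ((hβm.mul (hasFDerivAt_coord 0 x)).sub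
      (hγm.mul (hasFDerivAt_coord 1 x))).fderiv y).trans ?_
    simp only [comp_apply, sub_apply, add_apply, smul_apply, PiLp.proj_apply, smul_eq_mul,
      ContinuousLinearMap.comp_apply, axisymmetricField, Fin.zero_eta, PiLp.add_apply,
      Matrix.cons_val_zero]
    ring
  · refine (DFunLike.congr_fun ((hβm.mul (hasFDerivAt_coord 1 x)).add
      (hγm.mul (hasFDerivAt_coord 0 x))).fderiv y).trans ?_
    simp only [comp_apply, add_apply, smul_apply, PiLp.proj_apply, smul_eq_mul,
      ContinuousLinearMap.comp_apply, axisymmetricField, Fin.mk_one, PiLp.add_apply,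
      Matrix.cons_val_one, Matrix.cons_val_zero]
    ring
  · refine (DFunLike.congr_fun (hasFDerivAt_comp_meridian hw).fderiv y).trans ?_
    simp [axisymmetricField]

theorem fderiv_meridian_axisymmetricField :
    fderiv ℝ meridian x (axisymmetricField β γ w x) = meridianField β w (meridian x) := by
  rw [fderiv_meridian_apply]
  refine Prod.ext ?_ rfl
  simp only [axisymmetricField, meridianField, meridian, Matrix.cons_val_zero, Matrix.cons_val_one]
  ring

theorem hasGradientAt_comp_meridian (hq : DifferentiableAt ℝ q (meridian x)) :
    HasGradientAt (q ∘ meridian) (axisymmetricField (fun m => fderiv ℝ q m (1, 0)) 0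
      (fun m => fderiv ℝ q m (0, 1)) x) x := by
  rw [hasGradientAt_iff_hasFDerivAt]
  refine (hasFDerivAt_comp_meridian hq).congr_fderiv (ContinuousLinearMap.ext fun y => ?_)
  have hsplit : fderiv ℝ meridian x y =
      (x 0 * y 0 + x 1 * y 1) • (1, 0) + y 2 • ((0, 1) : ℝ × ℝ) := by
    simp [fderiv_meridian_apply]
  rw [ContinuousLinearMap.comp_apply, hsplit, map_add, map_smul, map_smul]
  simp only [axisymmetricField, toDual_apply_apply, PiLp.inner_apply, RCLike.inner_apply,
    conj_trivial, Fin.sum_univ_three, Matrix.cons_val_zero, Matrix.cons_val_one, Matrix.cons_val,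
    Pi.zero_apply, smul_eq_mul]
  ring

theorem divergence_axisymmetricField (hβ : DifferentiableAt ℝ β (meridian x))
    (hγ : DifferentiableAt ℝ γ (meridian x)) (hw : DifferentiableAt ℝ w (meridian x)) :
    divergence (axisymmetricField β γ w) x =
      2 * β (meridian x) + 2 * (meridian x).1 * fderiv ℝ β (meridian x) (1, 0) +
        fderiv ℝ w (meridian x) (0, 1) := by
  have hrad (f : ℝ × ℝ → ℝ) (r : ℝ) :
      fderiv ℝ f (meridian x) (r, 0) = r * fderiv ℝ f (meridian x) (1, 0) := by
    rw [← smul_eq_mul, ← map_smul, Prod.smul_mk, smul_eq_mul, smul_eq_mul, mul_one, mul_zero]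
  simp only [divergence, Fin.sum_univ_three, fderiv_axisymmetricField_apply hβ hγ hw,
    fderiv_meridian_apply]
  simp only [axisymmetricField, PiLp.add_apply, PiLp.single_apply, Fin.reduceEq, if_true, if_false,
    Matrix.cons_val_zero, Matrix.cons_val_one, Matrix.cons_val, Pi.zero_apply, mul_one, mul_zero,
    add_zero, zero_add, sub_zero, hrad _ (x _)]
  rw [meridian]
  ring

theorem advection_axisymmetricField (hβ : DifferentiableAt ℝ β (meridian x))
    (hγ : DifferentiableAt ℝ γ (meridian x)) (hw : DifferentiableAt ℝ w (meridian x)) :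
    advection (axisymmetricField β γ w) x = axisymmetricField
      (fun m => fderiv ℝ β m (meridianField β w m) + β m ^ 2 - γ m ^ 2)
      (fun m => fderiv ℝ γ m (meridianField β w m) + 2 * β m * γ m)
      (fun m => fderiv ℝ w m (meridianField β w m)) x := by
  rw [advection, fderiv_axisymmetricField_apply hβ hγ hw, fderiv_meridian_axisymmetricField]
  ext i
  fin_cases i
  · simp only [axisymmetricField, Fin.zero_eta, PiLp.add_apply, Matrix.cons_val_zero,
      Matrix.cons_val_one, Pi.zero_apply]
    ring
  · simp only [axisymmetricField, Fin.mk_one, PiLp.add_apply, Matrix.cons_val_zero,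
      Matrix.cons_val_one, Pi.zero_apply]
    ring
  · simp [axisymmetricField]

theorem isStationaryEulerAt_axisymmetricField (hβ : ContDiffAt ℝ ∞ β (meridian x))
    (hγ : ContDiffAt ℝ ∞ γ (meridian x)) (hw : ContDiffAt ℝ ∞ w (meridian x))
    (hq : ContDiffAt ℝ ∞ q (meridian x))
    (hdiv : 2 * β (meridian x) + 2 * (meridian x).1 * fderiv ℝ β (meridian x) (1, 0) +
      fderiv ℝ w (meridian x) (0, 1) = 0)
    (hradial : fderiv ℝ β (meridian x) (meridianField β w (meridian x)) + β (meridian x) ^ 2 -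
      γ (meridian x) ^ 2 + fderiv ℝ q (meridian x) (1, 0) = 0)
    (hangular : fderiv ℝ γ (meridian x) (meridianField β w (meridian x)) +
      2 * β (meridian x) * γ (meridian x) = 0)
    (haxial : fderiv ℝ w (meridian x) (meridianField β w (meridian x)) +
      fderiv ℝ q (meridian x) (0, 1) = 0) :
    IsStationaryEulerAt (axisymmetricField β γ w) (q ∘ meridian) x := by
  have hβd := hβ.differentiableAt (by simp)
  have hγd := hγ.differentiableAt (by simp)
  have hwd := hw.differentiableAt (by simp)
  refine ⟨contDiffAt_axisymmetricField hβ hγ hw, hq.comp x contDiff_meridian.contDiffAt, ?_,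
    (divergence_axisymmetricField hβd hγd hwd).trans hdiv⟩
  rw [advection_axisymmetricField hβd hγd hwd,
    (hasGradientAt_comp_meridian (hq.differentiableAt (by simp))).gradient]
  ext i
  fin_cases i
  · simp only [axisymmetricField, PiLp.add_apply, PiLp.zero_apply, Pi.zero_apply, Fin.zero_eta,
      Matrix.cons_val_zero]
    linear_combination x 0 * hradial - x 1 * hangular
  · simp only [axisymmetricField, PiLp.add_apply, PiLp.zero_apply, Pi.zero_apply, Fin.mk_one,
      Matrix.cons_val_one, Matrix.cons_val_zero]
    linear_combination x 1 * hradial + x 0 * hangular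
  · simpa [axisymmetricField] using haxial

theorem isCompact_preimage_meridian {K : Set (ℝ × ℝ)} (hK : IsCompact K) :
    IsCompact (meridian ⁻¹' K) := by
  obtain ⟨R, hR⟩ := hK.isBounded.exists_norm_le
  refine Metric.isCompact_of_isClosed_isBounded
    (hK.isClosed.preimage contDiff_meridian.continuous)
    (isBounded_iff_forall_norm_le.2 ⟨√(2 * R + R ^ 2), fun x hx => ?_⟩)
  have hm := norm_prod_le_iff.1 (hR _ hx)
  have h1 : (x 0 ^ 2 + x 1 ^ 2) / 2 ≤ R := (le_abs_self _).trans hm.1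
  have h2 : x 2 ^ 2 ≤ R ^ 2 := sq_le_sq.2 (hm.2.trans (le_abs_self R))
  rw [EuclideanSpace.norm_eq, Fin.sum_univ_three]
  refine Real.sqrt_le_sqrt ?_
  simp only [Real.norm_eq_abs, sq_abs]
  linarith

end Axisymmetric

section PowerSeries

open scoped NNReal

variable {a w : ℕ → ℝ} {r : ℝ≥0} {s : ℝ}

theorem norm_mul_pow_le (n : ℕ) (hs : s ∈ Metric.ball 0 (r : ℝ)) :
    ‖a n * s ^ n‖ ≤ |a n| * r ^ n := by
  rw [norm_mul, norm_pow]
  exact mul_le_mul_of_nonneg_left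
    (pow_le_pow_left₀ (norm_nonneg s) (mem_ball_zero_iff.1 hs).le n) (abs_nonneg (a n))

theorem summable_norm_mul_pow (ha : Summable fun n => |a n| * (r : ℝ) ^ n)
    (hs : s ∈ Metric.ball 0 (r : ℝ)) : Summable fun n => ‖a n * s ^ n‖ :=
  .of_nonneg_of_le (fun _ => norm_nonneg _) (fun n => norm_mul_pow_le n hs) ha

theorem contDiffOn_tsum_mul_pow (ha : Summable fun n => |a n| * (r : ℝ) ^ n) (hr : 0 < r) :
    ContDiffOn ℝ ∞ (fun s => ∑' n, a n * s ^ n) (Metric.ball 0 r) := by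
  let p := FormalMultilinearSeries.ofScalars ℝ a
  have hp : (r : ENNReal) ≤ p.radius := p.le_radius_of_summable_norm <| by
    simpa only [p, FormalMultilinearSeries.ofScalars_norm, Real.norm_eq_abs] using ha
  have hsum := (p.hasFPowerSeriesOnBall ((ENNReal.coe_pos.2 hr).trans_le hp)).analyticOnNhd
  rw [← Metric.eball_coe]
  refine ((hsum.contDiffOn Metric.isOpen_eball.uniqueDiffOn).mono
    (Metric.eball_subset_eball hp)).congr fun s _ => ?_
  simp only [p, FormalMultilinearSeries.sum, FormalMultilinearSeries.ofScalars_apply_eq,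
    smul_eq_mul]

theorem hasDerivAt_tsum_primitive (m : ℕ) (ha : Summable fun n => |a n| * (r : ℝ) ^ n)
    (hs : s ∈ Metric.ball 0 (r : ℝ)) :
    HasDerivAt (fun t => ∑' n, a n / (n + m + 1) * t ^ (n + m + 1)) (s ^ m * ∑' n, a n * s ^ n)
      s := by
  have hterm (n : ℕ) (t : ℝ) : HasDerivAt (fun t => a n / (n + m + 1) * t ^ (n + m + 1))
      (t ^ m * (a n * t ^ n)) t := by
    refine ((hasDerivAt_pow (n + m + 1) t).const_mul (a n / (n + m + 1))).congr_deriv ?_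
    have : (n : ℝ) + m + 1 ≠ 0 := by positivity
    rw [add_tsub_cancel_right]
    push_cast
    field_simp
    ring
  rw [← tsum_mul_left]
  refine hasDerivAt_tsum_of_isPreconnected (ha.mul_left ((r : ℝ) ^ m)) Metric.isOpen_ball
    (convex_ball (0 : ℝ) r).isPreconnected (fun n t _ => hterm n t) (fun n t ht => ?_)
    (Metric.mem_ball_self (dist_nonneg.trans_lt hs)) ?_ hs
  · rw [norm_mul, norm_pow]
    exact mul_le_mul (pow_le_pow_left₀ (norm_nonneg t) (mem_ball_zero_iff.1 ht).le m)
      (norm_mul_pow_le n ht) (norm_nonneg _) (by positivity)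
  · simp only [ne_eq, Nat.add_eq_zero_iff, one_ne_zero, and_false, not_false_eq_true, zero_pow,
      mul_zero, summable_zero]

/-- The solution of the Catalan recursion whose convolution carries weights `w` on the first factor;
it solves the fixed point equation `tsum_weightedCatalan`. -/
def weightedCatalan (w : ℕ → ℝ) : ℕ → ℝ
  | 0 => 1
  | n + 1 => ∑ i : Fin n.succ, w i * weightedCatalan w i * weightedCatalan w (n - i)

theorem weightedCatalan_zero : weightedCatalan w 0 = 1 := by rw [weightedCatalan]

theorem weightedCatalan_succ (n : ℕ) : weightedCatalan w (n + 1) =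
    ∑ i : Fin n.succ, w i * weightedCatalan w i * weightedCatalan w (n - i) := by
  rw [weightedCatalan]

theorem abs_weightedCatalan_le_catalan (hw : ∀ n, |w n| ≤ 1) (n : ℕ) :
    |weightedCatalan w n| ≤ catalan n := by
  induction n using Nat.strong_induction_on with
  | _ n ih =>
    cases n with
    | zero => rw [weightedCatalan_zero, abs_one, catalan_zero, Nat.cast_one]
    | succ n =>
      rw [weightedCatalan_succ, catalan_succ, Nat.cast_sum]
      refine (Finset.abs_sum_le_sum_abs _ _).trans (Finset.sum_le_sum fun i _ => ?_)
      rw [abs_mul, abs_mul, Nat.cast_mul]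
      refine mul_le_mul ?_ (ih _ (by omega)) (abs_nonneg _) (Nat.cast_nonneg _)
      exact (mul_le_of_le_one_left (abs_nonneg _) (hw i)).trans (ih i i.is_lt)

theorem abs_weightedCatalan_le (hw : ∀ n, |w n| ≤ 1) (n : ℕ) : |weightedCatalan w n| ≤ 4 ^ n := by
  have hcatalan : catalan n ≤ 4 ^ n := by
    rw [catalan_eq_centralBinom_div]
    exact (Nat.div_le_self _ _).trans (Nat.centralBinom_le_four_pow n)
  exact (abs_weightedCatalan_le_catalan hw n).trans (by exact_mod_cast hcatalan)

theorem summable_weightedCatalan (hw : ∀ n, |w n| ≤ 1) (hr : (r : ℝ) < 1 / 4) :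
    Summable fun n => |weightedCatalan w n| * (r : ℝ) ^ n := by
  refine .of_nonneg_of_le (fun n => by positivity) (fun n => ?_)
    (summable_geometric_of_lt_one (r := 4 * r) (by positivity) (by linarith))
  rw [mul_pow]
  gcongr
  exact abs_weightedCatalan_le hw n

theorem tsum_weightedCatalan (hw : ∀ n, |w n| ≤ 1) (hr : (r : ℝ) < 1 / 4)
    (hs : s ∈ Metric.ball 0 (r : ℝ)) :
    ∑' n, weightedCatalan w n * s ^ n = 1 + s * ((∑' n, w n * weightedCatalan w n * s ^ n) *
      ∑' n, weightedCatalan w n * s ^ n) := by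
  have ha := summable_norm_mul_pow (summable_weightedCatalan hw hr) hs
  have hwa : Summable fun n => ‖w n * weightedCatalan w n * s ^ n‖ := by
    refine .of_nonneg_of_le (fun _ => norm_nonneg _) (fun n => ?_) ha
    rw [mul_assoc, norm_mul]
    exact mul_le_of_le_one_left (norm_nonneg _) (hw n)
  rw [tsum_mul_tsum_eq_tsum_sum_antidiagonal_of_summable_norm hwa ha, ha.of_norm.tsum_eq_zero_add,
    ← tsum_mul_left, weightedCatalan_zero, pow_zero, mul_one]
  congr 1
  refine tsum_congr fun n => ?_
  rw [weightedCatalan_succ, ← Finset.sum_range (n := n.succ)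
    (fun i => w i * weightedCatalan w i * weightedCatalan w (n - i)),
    Finset.Nat.sum_antidiagonal_eq_sum_range_succ_mk, pow_succ', Finset.sum_mul, Finset.mul_sum]
  refine Finset.sum_congr rfl fun i hi => ?_
  rw [show s ^ n = s ^ i * s ^ (n - i) by
    rw [← pow_add, Nat.add_sub_cancel' (Finset.mem_range_succ_iff.1 hi)]]
  ring

end PowerSeries

section LevelProfile

/-- Profile functions of an axisymmetric stationary Euler flow whose pressure `ψ` is its stream
function, in the coordinates `ρ = r ^ 2 / 2` and `z`: the axial velocity is `-(ρ + k ψ)`, the square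
of the angular momentum `r u_θ` is `W ψ`, and `j` is the derivative of `k`. The equations for `W`
are the ones that make `axialSq` compatible with the equality of mixed second derivatives of `ψ`. -/
structure LevelProfile where
  dom : Set ℝ
  k : ℝ → ℝ
  j : ℝ → ℝ
  W : ℝ → ℝ
  isOpen_dom : IsOpen dom
  zero_mem : 0 ∈ dom
  contDiffOn_j : ContDiffOn ℝ ∞ j dom
  hasDerivAt_k : ∀ s ∈ dom, HasDerivAt k (j s) s
  hasDerivAt_W : ∀ s ∈ dom, HasDerivAt W (-(12 * s * j s + 2 * k s)) s
  W_mul_j : ∀ s ∈ dom, W s * j s = -3 * s * (1 + 2 * k s * j s)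
  j_pos : ∀ s ∈ dom, 0 < j s
  one_add_two_mul_neg : ∀ s ∈ dom, 1 + 2 * k s * j s < 0
  k_zero : k 0 = -3 / 4
  j_zero : j 0 = 1

/-- The weights for which the power series with coefficients `weightedCatalan profileWeight` is the
function `j` of a level profile. -/
def profileWeight (n : ℕ) : ℝ := 4 / 3 * (1 / (n + 1)) - 10 / 3 * (1 / (n + 2))

theorem abs_profileWeight_le (n : ℕ) : |profileWeight n| ≤ 1 := by
  have hweight : profileWeight n = -((6 * n + 2) / (3 * ((n + 1) * (n + 2)))) := by
    have h1 : (n : ℝ) + 1 ≠ 0 := by positivity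
    have h2 : (n : ℝ) + 2 ≠ 0 := by positivity
    rw [profileWeight]
    field_simp
    ring
  rw [hweight, abs_neg, abs_of_nonneg (by positivity), div_le_one (by positivity)]
  nlinarith [n.cast_nonneg (α := ℝ)]

theorem sq_mul_tsum_profileWeight {a : ℕ → ℝ} {s : ℝ} (ha : Summable fun n => ‖a n * s ^ n‖) :
    s ^ 2 * ∑' n, profileWeight n * a n * s ^ n =
      4 / 3 * s * (∑' n : ℕ, a n / (n + 1) * s ^ (n + 1)) -
        10 / 3 * ∑' n : ℕ, a n / (n + 2) * s ^ (n + 2) := by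
  have hsum (m : ℕ) : Summable fun n : ℕ => a n / (n + m) * s ^ (n + m) := by
    refine .of_norm_bounded_eventually_nat (ha.mul_left ‖s ^ m‖) ?_
    filter_upwards [eventually_ge_atTop 1] with n hn
    rw [pow_add, div_mul_eq_mul_div, norm_div, ← mul_assoc, norm_mul, mul_comm]
    refine div_le_self (by positivity) ?_
    rw [Real.norm_of_nonneg (by positivity)]
    exact_mod_cast hn.trans (Nat.le_add_right n m)
  have h1 := hsum 1
  have h2 := hsum 2
  push_cast at h1 h2
  rw [← tsum_mul_left, ← tsum_mul_left, ← tsum_mul_left,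
    ← (h1.mul_left _).tsum_sub (h2.mul_left _)]
  refine tsum_congr fun n => ?_
  rw [profileWeight]
  ring

theorem exists_profile_on_ball : ∃ r > 0, ∃ k j W : ℝ → ℝ,
    ContDiffOn ℝ ∞ j (Metric.ball 0 r) ∧
    (∀ s ∈ Metric.ball 0 r, HasDerivAt k (j s) s) ∧
    (∀ s ∈ Metric.ball 0 r, HasDerivAt W (-(12 * s * j s + 2 * k s)) s) ∧
    (∀ s ∈ Metric.ball 0 r, W s * j s = -3 * s * (1 + 2 * k s * j s)) ∧
    k 0 = -3 / 4 ∧ j 0 = 1 := by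
  let a := weightedCatalan profileWeight
  let r : NNReal := 1 / 8
  have hr : (r : ℝ) < 1 / 4 := by simp only [r]; norm_num
  have hr₀ : 0 < r := by simp only [r]; norm_num
  have ha : Summable fun n => |a n| * (r : ℝ) ^ n :=
    summable_weightedCatalan abs_profileWeight_le hr
  let j (s : ℝ) : ℝ := ∑' n, a n * s ^ n
  let K (s : ℝ) : ℝ := ∑' n : ℕ, a n / (n + 1) * s ^ (n + 1)
  let S (s : ℝ) : ℝ := ∑' n : ℕ, a n / (n + 2) * s ^ (n + 2)
  have hK (s) (hs : s ∈ Metric.ball 0 (r : ℝ)) : HasDerivAt K (j s) s := by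
    simpa [K] using hasDerivAt_tsum_primitive 0 ha hs
  have hS (s) (hs : s ∈ Metric.ball 0 (r : ℝ)) : HasDerivAt S (s * j s) s := by
    simpa [S, add_assoc, one_add_one_eq_two] using hasDerivAt_tsum_primitive 1 ha hs
  refine ⟨r, hr₀, fun s => -3 / 4 + K s, j, fun s => 3 / 2 * s - 10 * S s - 2 * (s * K s),
    contDiffOn_tsum_mul_pow ha hr₀, fun s hs => (hK s hs).const_add _, fun s hs => ?_,
    fun s hs => ?_, by simp [K], ?_⟩
  · refine ((((hasDerivAt_id s).const_mul _).sub ((hS s hs).const_mul 10)).sub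
      (((hasDerivAt_id s).mul (hK s hs)).const_mul 2)).congr_deriv ?_
    simp only [id]
    ring
  · have hfix : j s = 1 + s * ((∑' n, profileWeight n * a n * s ^ n) * j s) :=
      tsum_weightedCatalan abs_profileWeight_le hr hs
    have hg : s ^ 2 * ∑' n, profileWeight n * a n * s ^ n = 4 / 3 * s * K s - 10 / 3 * S s :=
      sq_mul_tsum_profileWeight (summable_norm_mul_pow ha hs)
    linear_combination -3 * s * hfix - 3 * j s * hg
  · exact (tsum_eq_single 0 fun n hn => by simp [hn]).trans (by simp [a, weightedCatalan_zero])

theorem nonempty_levelProfile : Nonempty LevelProfile := by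
  obtain ⟨r, hr, k, j, W, hj, hk, hW, hWj, hk₀, hj₀⟩ := exists_profile_on_ball
  have hkj : ContinuousOn (fun s => 1 + 2 * k s * j s) (Metric.ball 0 r) :=
    continuousOn_const.add ((continuousOn_const.mul fun s hs =>
      (hk s hs).continuousAt.continuousWithinAt).mul hj.continuousOn)
  have h₀ : (0 : ℝ) ∈ Metric.ball 0 r := Metric.mem_ball_self hr
  exact ⟨{
    dom := (Metric.ball 0 r ∩ j ⁻¹' Ioi 0) ∩
      (Metric.ball 0 r ∩ (fun s => 1 + 2 * k s * j s) ⁻¹' Iio 0)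
    k := k
    j := j
    W := W
    isOpen_dom := (hj.continuousOn.isOpen_inter_preimage Metric.isOpen_ball isOpen_Ioi).inter
      (hkj.isOpen_inter_preimage Metric.isOpen_ball isOpen_Iio)
    zero_mem := ⟨⟨h₀, by simp [hj₀]⟩, h₀, by norm_num [hj₀, hk₀]⟩
    contDiffOn_j := hj.mono fun s hs => hs.1.1
    hasDerivAt_k := fun s hs => hk s hs.1.1
    hasDerivAt_W := fun s hs => hW s hs.1.1
    W_mul_j := fun s hs => hWj s hs.1.1
    j_pos := fun s hs => hs.1.2
    one_add_two_mul_neg := fun s hs => hs.2.2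
    k_zero := hk₀
    j_zero := hj₀ }⟩

end LevelProfile

section PlaneCalculus

variable {E F : Type*} [NormedAddCommGroup E] [NormedSpace ℝ E] [NormedAddCommGroup F]
  [NormedSpace ℝ F]

theorem contDiffOn_of_hasDerivAt {f f' : ℝ → F} {s : Set ℝ} (hs : IsOpen s)
    (hf' : ContDiffOn ℝ ∞ f' s) (hf : ∀ x ∈ s, HasDerivAt f (f' x) x) : ContDiffOn ℝ ∞ f s :=
  (contDiffOn_infty_iff_deriv_of_isOpen hs).2
    ⟨fun x hx => (hf x hx).differentiableAt.differentiableWithinAt,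
      hf'.congr fun x hx => (hf x hx).deriv⟩

theorem contDiffOn_of_hasFDerivAt_comp {U : Set E} (hU : IsOpen U) {f : E → F}
    {A : E × F → E →L[ℝ] F} {s : Set (E × F)} (hA : ContDiffOn ℝ ∞ A s)
    (hs : ∀ x ∈ U, (x, f x) ∈ s) (hf : ∀ x ∈ U, HasFDerivAt f (A (x, f x)) x) :
    ContDiffOn ℝ ∞ f U := by
  rw [contDiffOn_infty]
  intro n
  induction n with
  | zero => exact contDiffOn_zero.2 fun x hx => (hf x hx).continuousAt.continuousWithinAt
  | succ n ih =>
    rw [Nat.cast_add, Nat.cast_one, contDiffOn_succ_iff_fderiv_of_isOpen hU]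
    refine ⟨fun x hx => (hf x hx).differentiableAt.differentiableWithinAt, by simp, ?_⟩
    have hAf : ContDiffOn ℝ n (fun x => A (x, f x)) U :=
      (hA.of_le (by exact_mod_cast le_top)).comp (contDiffOn_id.prodMk ih) hs
    exact hAf.congr fun x hx => (hf x hx).fderiv

theorem hasFDerivAt_of_comp_graph_eventuallyEq_const {f : E × ℝ → ℝ} {g : E → ℝ} {x : E} {c : ℝ}
    {L : E × ℝ →L[ℝ] ℝ} {G : E →L[ℝ] ℝ} (hg : DifferentiableAt ℝ g x)
    (hfg : (fun y => f (y, g y)) =ᶠ[𝓝 x] fun _ => c) (hf : HasFDerivAt f L (x, g x))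
    (hL : L (0, 1) ≠ 0) (hG : ∀ y, L (y, G y) = 0) : HasFDerivAt g G x := by
  have hcomp : HasFDerivAt (fun y => f (y, g y)) (L ∘L (.prod (.id ℝ E) (fderiv ℝ g x))) x :=
    hf.comp x ((hasFDerivAt_id x).prodMk hg.hasFDerivAt)
  have hconst := hcomp.unique ((hasFDerivAt_const c x).congr_of_eventuallyEq hfg)
  refine hg.hasFDerivAt.congr_fderiv (ContinuousLinearMap.ext fun y => sub_eq_zero.1 ?_)
  have hy : L (y, fderiv ℝ g x y) = 0 := DFunLike.congr_fun hconst y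
  have hdiff : (fderiv ℝ g x y - G y) • ((0, 1) : E × ℝ) = (y, fderiv ℝ g x y) - (y, G y) := by
    simp
  refine (mul_eq_zero.1 ?_).resolve_right hL
  rw [← smul_eq_mul, ← map_smul, hdiff, map_sub, hy, hG, sub_zero]

theorem exists_implicit_scalar [CompleteSpace E] {f : E × ℝ → ℝ} {x₀ : E} {t₀ : ℝ}
    (hf : ContDiffAt ℝ 1 f (x₀, t₀)) (hL : fderiv ℝ f (x₀, t₀) (0, 1) ≠ 0) :
    ∃ g : E → ℝ, g x₀ = t₀ ∧ ContinuousAt g x₀ ∧ ∀ᶠ x in 𝓝 x₀, f (x, g x) = f (x₀, t₀) ∧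
      ∀ (L : E × ℝ →L[ℝ] ℝ) (G : E →L[ℝ] ℝ), HasFDerivAt f L (x, g x) →
        (∀ y, L (y, G y) = 0) → HasFDerivAt g G x := by
  have hinv : (fderiv ℝ f (x₀, t₀) ∘L .inr ℝ E ℝ).IsInvertible := by
    refine ⟨ContinuousLinearEquiv.unitsEquivAut ℝ (Units.mk0 _ hL), ?_⟩
    ext
    simp
  let g := hf.implicitFunction one_ne_zero hinv
  have hg : ContDiffAt ℝ 1 g x₀ := hf.contDiffAt_implicitFunction one_ne_zero hinv
  have hg₀ : g x₀ = t₀ := hf.implicitFunction_apply_self one_ne_zero hinv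
  have hfg : ∀ᶠ x in 𝓝 x₀, f (x, g x) = f (x₀, t₀) :=
    hf.eventually_apply_implicitFunction one_ne_zero hinv
  have hgraph : Tendsto (fun x => (x, g x)) (𝓝 x₀) (𝓝 (x₀, t₀)) := by
    simpa only [hg₀, id] using (continuousAt_id.prodMk hg.continuousAt).tendsto
  have hne : ∀ᶠ x in 𝓝 x₀, fderiv ℝ f (x, g x) (0, 1) ≠ 0 := by
    have hcont : ContinuousAt (fun y => fderiv ℝ f y (0, 1)) (x₀, t₀) :=
      (hf.continuousAt_fderiv one_ne_zero).clm_apply continuousAt_const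
    exact hgraph.eventually (hcont.eventually_ne hL)
  refine ⟨g, hg₀, hg.continuousAt, ?_⟩
  filter_upwards [hfg, hfg.eventually_nhds, hne, hg.eventually (by simp)] with x h₁ h₂ h₃ h₄
  refine ⟨h₁, fun L G hL' hG => hasFDerivAt_of_comp_graph_eventuallyEq_const
    (h₄.differentiableAt one_ne_zero) h₂ hL' ?_ hG⟩
  rwa [← hL'.fderiv]

/-- The linear functional `(x, y) ↦ a x + b y` on the plane. -/
def covector (a b : ℝ) : ℝ × ℝ →L[ℝ] ℝ :=
  a • ContinuousLinearMap.fst ℝ ℝ ℝ + b • ContinuousLinearMap.snd ℝ ℝ ℝ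

theorem covector_apply (a b : ℝ) (x : ℝ × ℝ) : covector a b x = a * x.1 + b * x.2 := rfl

theorem exists_implicit_plane {F : ℝ × ℝ → ℝ} {φ : ℝ → ℝ} {c : ℝ × ℝ} {t₀ : ℝ}
    (hF : ContDiffAt ℝ 1 F (c.1, t₀)) (hφ : ContDiff ℝ 1 φ) (h₀ : F (c.1, t₀) = φ c.2)
    (hne : fderiv ℝ F (c.1, t₀) (0, 1) ≠ 0) :
    ∃ g : ℝ × ℝ → ℝ, g c = t₀ ∧ Tendsto (fun p => (p.1, g p)) (𝓝 c) (𝓝 (c.1, t₀)) ∧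
      ∀ᶠ p in 𝓝 c, F (p.1, g p) = φ p.2 ∧ ∀ a b, HasFDerivAt F (covector a b) (p.1, g p) →
        b ≠ 0 → HasFDerivAt g (covector (-(a / b)) (deriv φ p.2 / b)) p := by
  let e : (ℝ × ℝ) × ℝ →L[ℝ] ℝ × ℝ := ((ContinuousLinearMap.fst ℝ ℝ ℝ).comp
    (ContinuousLinearMap.fst ℝ (ℝ × ℝ) ℝ)).prod (ContinuousLinearMap.snd ℝ (ℝ × ℝ) ℝ)
  let z : (ℝ × ℝ) × ℝ →L[ℝ] ℝ :=
    (ContinuousLinearMap.snd ℝ ℝ ℝ).comp (ContinuousLinearMap.fst ℝ (ℝ × ℝ) ℝ)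
  let f (y : (ℝ × ℝ) × ℝ) : ℝ := F (e y) - φ (z y)
  have hf {y : (ℝ × ℝ) × ℝ} {L : ℝ × ℝ →L[ℝ] ℝ} (h : HasFDerivAt F L (e y)) :
      HasFDerivAt f (L ∘L e - deriv φ (z y) • z) y :=
    (h.comp y e.hasFDerivAt).sub
      ((hφ.differentiable one_ne_zero _).hasDerivAt.comp_hasFDerivAt y z.hasFDerivAt)
  have hsmooth : ContDiffAt ℝ 1 f (c, t₀) :=
    (ContDiffAt.comp (g := F) (c, t₀) hF e.contDiff.contDiffAt).sub
      (hφ.comp z.contDiff).contDiffAt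
  have hf₀ : f (c, t₀) = 0 := sub_eq_zero.2 h₀
  obtain ⟨g, hg₀, hg, himp⟩ := exists_implicit_scalar hsmooth <| by
    rw [(hf (y := (c, t₀)) (hF.differentiableAt one_ne_zero).hasFDerivAt).fderiv]
    simpa [e, z] using hne
  refine ⟨g, hg₀, by simpa only [hg₀] using (continuousAt_fst.prodMk hg).tendsto, ?_⟩
  filter_upwards [himp] with p ⟨hfp, hderiv⟩
  refine ⟨sub_eq_zero.1 (hfp.trans hf₀), fun a b hab hb =>
    hderiv _ _ (hf (y := (p, g p)) hab) fun y => ?_⟩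
  simp only [e, z, covector_apply, sub_apply, smul_apply, smul_eq_mul,
    ContinuousLinearMap.comp_apply, ContinuousLinearMap.prod_apply, ContinuousLinearMap.coe_fst',
    ContinuousLinearMap.coe_snd']
  field_simp
  ring

theorem contDiffOn_covector {α β : E → ℝ} {s : Set E} {n : WithTop ℕ∞} (hα : ContDiffOn ℝ n α s)
    (hβ : ContDiffOn ℝ n β s) : ContDiffOn ℝ n (fun x => covector (α x) (β x)) s :=
  (hα.smul contDiffOn_const).add (hβ.smul contDiffOn_const)

theorem hasFDerivAt_covector {α β : E → ℝ} {α' β' : E →L[ℝ] ℝ} {x : E} (hα : HasFDerivAt α α' x)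
    (hβ : HasFDerivAt β β' x) : HasFDerivAt (fun x => covector (α x) (β x))
      (α'.smulRight (ContinuousLinearMap.fst ℝ ℝ ℝ) +
        β'.smulRight (ContinuousLinearMap.snd ℝ ℝ ℝ)) x :=
  (HasFDerivAt.smul_const (𝕜' := ℝ) hα (ContinuousLinearMap.fst ℝ ℝ ℝ)).add
    (HasFDerivAt.smul_const (𝕜' := ℝ) hβ (ContinuousLinearMap.snd ℝ ℝ ℝ))

theorem clm_plane_apply (L : ℝ × ℝ →L[ℝ] ℝ) (x : ℝ × ℝ) :
    L x = x.1 * L (1, 0) + x.2 * L (0, 1) := by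
  rw [← smul_eq_mul, ← smul_eq_mul, ← map_smul, ← map_smul, ← map_add]
  simp

theorem exists_local_primitive_covector {α β : ℝ × ℝ → ℝ} {c : ℝ × ℝ}
    (hα : ∀ᶠ p in 𝓝 c, DifferentiableAt ℝ α p) (hβ : ∀ᶠ p in 𝓝 c, DifferentiableAt ℝ β p)
    (hclosed : ∀ᶠ p in 𝓝 c, fderiv ℝ α p (0, 1) = fderiv ℝ β p (1, 0)) :
    ∃ f : ℝ × ℝ → ℝ, f c = 0 ∧ ContDiffAt ℝ 1 f c ∧
      ∀ᶠ p in 𝓝 c, HasFDerivAt f (covector (α p) (β p)) p := by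
  obtain ⟨ε, hε, hball⟩ := Metric.eventually_nhds_iff_ball.1 (hα.and (hβ.and hclosed))
  have hderiv (p) (hp : p ∈ Metric.ball c ε) :=
    hasFDerivAt_covector (hball p hp).1.hasFDerivAt (hball p hp).2.1.hasFDerivAt
  have hsymm (p) (hp : p ∈ Metric.ball c ε) (x y : ℝ × ℝ) :
      fderiv ℝ (fun p => covector (α p) (β p)) p x y =
        fderiv ℝ (fun p => covector (α p) (β p)) p y x := by
    rw [(hderiv p hp).fderiv]
    change fderiv ℝ α p x * y.1 + fderiv ℝ β p x * y.2 =
      fderiv ℝ α p y * x.1 + fderiv ℝ β p y * x.2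
    rw [clm_plane_apply _ x, clm_plane_apply _ y, clm_plane_apply (fderiv ℝ β p) x,
      clm_plane_apply (fderiv ℝ β p) y, (hball p hp).2.2]
    ring
  obtain ⟨f, hf⟩ := (convex_ball c ε).exists_forall_hasFDerivAt_of_fderiv_symmetric
    Metric.isOpen_ball (fun p hp => (hderiv p hp).differentiableAt.differentiableWithinAt) hsymm
  have hnhds : Metric.ball c ε ∈ 𝓝 c := Metric.ball_mem_nhds c hε
  have hsmooth : ContDiffAt ℝ 1 f c := contDiffAt_one_iff.2 ⟨_, _, hnhds,
    fun p hp => (hderiv p hp).continuousAt.continuousWithinAt, hf⟩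
  refine ⟨fun p => f p - f c, sub_self _, hsmooth.sub contDiffAt_const, ?_⟩
  filter_upwards [hnhds] with p hp
  exact (hf p hp).sub_const _

end PlaneCalculus

section Hodograph

variable (P : LevelProfile)

namespace LevelProfile

theorem contDiffOn_k : ContDiffOn ℝ ∞ P.k P.dom :=
  contDiffOn_of_hasDerivAt P.isOpen_dom P.contDiffOn_j P.hasDerivAt_k

theorem contDiffOn_W : ContDiffOn ℝ ∞ P.W P.dom :=
  contDiffOn_of_hasDerivAt P.isOpen_dom
    (((contDiffOn_const.mul contDiffOn_id).mul P.contDiffOn_j).add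
      (contDiffOn_const.mul P.contDiffOn_k)).neg P.hasDerivAt_W

variable {s : ℝ}

theorem hasDerivAt_j (hs : s ∈ P.dom) : HasDerivAt P.j (deriv P.j s) s :=
  ((P.contDiffOn_j.contDiffAt (P.isOpen_dom.mem_nhds hs)).differentiableAt (by simp)).hasDerivAt

theorem W_mul_deriv_j (hs : s ∈ P.dom) : P.W s * deriv P.j s =
    -3 - 4 * P.k s * P.j s + 6 * s * (P.j s ^ 2 - P.k s * deriv P.j s) := by
  have hleft := (P.hasDerivAt_W s hs).mul (P.hasDerivAt_j hs)
  have hright := ((hasDerivAt_id s).const_mul (-3)).mul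
    ((((P.hasDerivAt_k s hs).const_mul 2).mul (P.hasDerivAt_j hs)).const_add 1)
  have hderiv := hleft.unique <| hright.congr_of_eventuallyEq <| by
    filter_upwards [P.isOpen_dom.mem_nhds hs] with t ht using P.W_mul_j t ht
  simp only [id, Pi.mul_apply] at hderiv
  linear_combination hderiv

theorem W_pos (hs : s ∈ P.dom) (hs₀ : 0 < s) : 0 < P.W s := by
  refine pos_of_mul_pos_left (b := P.j s) ?_ (P.j_pos s hs).le
  rw [P.W_mul_j s hs]
  nlinarith [P.one_add_two_mul_neg s hs]

/-- The square of the axial derivative of the stream function, as a function of `ρ` and of the value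
of the stream function. It makes the square of the speed three times the pressure. -/
def axialSq (q : ℝ × ℝ) : ℝ := 2 * q.1 * (3 * q.2 - (q.1 + P.k q.2) ^ 2) - P.W q.2

/-- The derivative of `axialSq` with respect to the value of the stream function. -/
def axialSqDeriv (q : ℝ × ℝ) : ℝ :=
  6 * q.1 + 2 * P.k q.2 + P.j q.2 * (12 * q.2 - 4 * q.1 * (q.1 + P.k q.2))

variable {q : ℝ × ℝ}

theorem hasFDerivAt_axialSq (hq : q.2 ∈ P.dom) :
    HasFDerivAt P.axialSq (covector (2 * P.j q.2 * P.axialSq q -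
      (q.1 + P.k q.2) * P.axialSqDeriv q) (P.axialSqDeriv q)) q := by
  have hρ := hasFDerivAt_fst (𝕜 := ℝ) (E := ℝ) (F := ℝ) (p := q)
  have hs := hasFDerivAt_snd (𝕜 := ℝ) (E := ℝ) (F := ℝ) (p := q)
  have hk := (P.hasDerivAt_k _ hq).comp_hasFDerivAt q hs
  have hW := (P.hasDerivAt_W _ hq).comp_hasFDerivAt q hs
  refine (((hρ.const_mul 2).mul ((hs.const_mul 3).sub ((hρ.add hk).pow 2))).sub hW).congr_fderiv
    (ContinuousLinearMap.ext fun y => ?_)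
  simp only [covector_apply, axialSq, axialSqDeriv, Pi.add_apply, Pi.sub_apply, comp_apply,
    add_apply, sub_apply, smul_apply, ContinuousLinearMap.coe_fst', ContinuousLinearMap.coe_snd',
    smul_eq_mul, nsmul_eq_mul, Nat.add_one_sub_one, Nat.cast_ofNat, pow_one]
  linear_combination 2 * y.1 * P.W_mul_j _ hq

theorem hasFDerivAt_axialSqDeriv (hq : q.2 ∈ P.dom) :
    HasFDerivAt P.axialSqDeriv (covector (6 - P.j q.2 * (8 * q.1 + 4 * P.k q.2))
      (14 * P.j q.2 - 4 * q.1 * P.j q.2 ^ 2 +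
        deriv P.j q.2 * (12 * q.2 - 4 * q.1 * (q.1 + P.k q.2)))) q := by
  have hρ := hasFDerivAt_fst (𝕜 := ℝ) (E := ℝ) (F := ℝ) (p := q)
  have hs := hasFDerivAt_snd (𝕜 := ℝ) (E := ℝ) (F := ℝ) (p := q)
  have hk := (P.hasDerivAt_k _ hq).comp_hasFDerivAt q hs
  have hj := (P.hasDerivAt_j hq).comp_hasFDerivAt q hs
  refine (((hρ.const_mul 6).add (hk.const_mul 2)).add (hj.mul ((hs.const_mul 12).sub
    ((hρ.const_mul 4).mul (hρ.add hk))))).congr_fderiv (ContinuousLinearMap.ext fun y => ?_)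
  simp only [covector_apply, Pi.add_apply, Pi.sub_apply, Pi.mul_apply, comp_apply, add_apply,
    sub_apply, smul_apply, ContinuousLinearMap.coe_fst', ContinuousLinearMap.coe_snd', smul_eq_mul]
  ring

theorem axialSqDeriv_compatibility (hq : q.2 ∈ P.dom) :
    6 - P.j q.2 * (8 * q.1 + 4 * P.k q.2) + (14 * P.j q.2 - 4 * q.1 * P.j q.2 ^ 2 +
        deriv P.j q.2 * (12 * q.2 - 4 * q.1 * (q.1 + P.k q.2))) * (q.1 + P.k q.2) =
      P.j q.2 * P.axialSqDeriv q + 2 * P.axialSq q * deriv P.j q.2 := by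
  rw [axialSq, axialSqDeriv]
  linear_combination 2 * P.W_mul_deriv_j hq

theorem j_mul_axialSq (hq : q.2 ∈ P.dom) : P.j q.2 * P.axialSq q =
    P.axialSqDeriv q * (q.1 + P.k q.2) / 2 + 3 * q.2 - (q.1 + P.k q.2) * (3 * q.1 + P.k q.2) := by
  rw [axialSq, axialSqDeriv]
  linear_combination -P.W_mul_j _ hq

theorem contDiffOn_axialSq : ContDiffOn ℝ ∞ P.axialSq {q | q.2 ∈ P.dom} := by
  have hk := P.contDiffOn_k.comp contDiffOn_snd fun q (hq : q ∈ {q : ℝ × ℝ | q.2 ∈ P.dom}) => hq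
  have hW := P.contDiffOn_W.comp contDiffOn_snd fun q (hq : q ∈ {q : ℝ × ℝ | q.2 ∈ P.dom}) => hq
  exact ((contDiffOn_const.mul contDiffOn_fst).mul ((contDiffOn_const.mul contDiffOn_snd).sub
    ((contDiffOn_fst.add hk).pow 2))).sub hW

theorem contDiffOn_axialSqDeriv : ContDiffOn ℝ ∞ P.axialSqDeriv {q | q.2 ∈ P.dom} := by
  have hk := P.contDiffOn_k.comp contDiffOn_snd fun q (hq : q ∈ {q : ℝ × ℝ | q.2 ∈ P.dom}) => hq
  have hj := P.contDiffOn_j.comp contDiffOn_snd fun q (hq : q ∈ {q : ℝ × ℝ | q.2 ∈ P.dom}) => hq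
  exact ((contDiffOn_const.mul contDiffOn_fst).add (contDiffOn_const.mul hk)).add
    (hj.mul ((contDiffOn_const.mul contDiffOn_snd).sub
      ((contDiffOn_const.mul contDiffOn_fst).mul (contDiffOn_fst.add hk))))

theorem axialSq_center : P.axialSq (3 / 4, 0) = 0 := by
  have hW : P.W 0 = 0 := by simpa [P.j_zero] using P.W_mul_j 0 P.zero_mem
  norm_num [axialSq, P.k_zero, hW]

theorem axialSqDeriv_center : P.axialSqDeriv (3 / 4, 0) = 3 := by
  norm_num [axialSqDeriv, P.k_zero, P.j_zero]

/-- `Ψ` expresses the value of the stream function near `p = (ρ, v)` through `ρ` and the axial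
derivative `v` of the stream function. -/
structure IsHodographAt (Ψ : ℝ × ℝ → ℝ) (p : ℝ × ℝ) : Prop where
  mem_dom : Ψ p ∈ P.dom
  axialSq_eq : P.axialSq (p.1, Ψ p) = p.2 ^ 2
  axialSqDeriv_pos : 0 < P.axialSqDeriv (p.1, Ψ p)
  hasFDerivAt : HasFDerivAt Ψ
    (covector (p.1 + P.k (Ψ p) - 2 * p.2 ^ 2 * P.j (Ψ p) / P.axialSqDeriv (p.1, Ψ p))
      (2 * p.2 / P.axialSqDeriv (p.1, Ψ p))) p

theorem exists_hodograph : ∃ Ψ : ℝ × ℝ → ℝ, Ψ (3 / 4, 0) = 0 ∧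
    ∀ᶠ p in 𝓝 ((3 / 4, 0) : ℝ × ℝ), P.IsHodographAt Ψ p := by
  have hnhds : {q : ℝ × ℝ | q.2 ∈ P.dom} ∈ 𝓝 ((3 / 4, 0) : ℝ × ℝ) :=
    (P.isOpen_dom.preimage continuous_snd).mem_nhds P.zero_mem
  have hcont : ContinuousAt P.axialSqDeriv (3 / 4, 0) :=
    (P.contDiffOn_axialSqDeriv.contDiffAt hnhds).continuousAt
  obtain ⟨Ψ, hΨ₀, hgraph, himp⟩ := exists_implicit_plane (c := (3 / 4, 0)) (t₀ := 0)
    (φ := fun v => v ^ 2) ((P.contDiffOn_axialSq.contDiffAt hnhds).of_le (by simp))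
    (by fun_prop) (by simp [P.axialSq_center]) <| by
      rw [(P.hasFDerivAt_axialSq P.zero_mem).fderiv]
      simp [covector_apply, P.axialSqDeriv_center]
  refine ⟨Ψ, hΨ₀, ?_⟩
  filter_upwards [himp, hgraph.eventually_mem hnhds,
    hgraph.eventually (hcont.eventually (lt_mem_nhds (P.axialSqDeriv_center.symm ▸ three_pos)))]
    with p ⟨hsq, hderiv⟩ hp hD
  refine ⟨hp, hsq, hD, ?_⟩
  convert hderiv _ _ (P.hasFDerivAt_axialSq hp) hD.ne' using 2
  · rw [hsq]
    field_simp
    ring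
  · simp

variable {P} {Ψ : ℝ × ℝ → ℝ} {p : ℝ × ℝ}

namespace IsHodographAt

theorem hasFDerivAt_axialSqDeriv_graph (h : P.IsHodographAt Ψ p) :
    HasFDerivAt (fun p => P.axialSqDeriv (p.1, Ψ p)) (fderiv ℝ P.axialSqDeriv (p.1, Ψ p) ∘L
      (ContinuousLinearMap.fst ℝ ℝ ℝ).prod (fderiv ℝ Ψ p)) p :=
  HasFDerivAt.comp (g := P.axialSqDeriv) p
    (P.hasFDerivAt_axialSqDeriv h.mem_dom).differentiableAt.hasFDerivAt
    (hasFDerivAt_fst.prodMk h.hasFDerivAt.differentiableAt.hasFDerivAt)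

theorem axialCoordinate_closed (h : P.IsHodographAt Ψ p) :
    DifferentiableAt ℝ (fun p => -(2 * p.2 * P.j (Ψ p)) * (P.axialSqDeriv (p.1, Ψ p))⁻¹) p ∧
    DifferentiableAt ℝ (fun p => 2 * (P.axialSqDeriv (p.1, Ψ p))⁻¹) p ∧
    fderiv ℝ (fun p => -(2 * p.2 * P.j (Ψ p)) * (P.axialSqDeriv (p.1, Ψ p))⁻¹) p (0, 1) =
      fderiv ℝ (fun p => 2 * (P.axialSqDeriv (p.1, Ψ p))⁻¹) p (1, 0) := by
  have hD := h.axialSqDeriv_pos.ne'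
  have hinv := (hasDerivAt_inv hD).comp_hasFDerivAt p h.hasFDerivAt_axialSqDeriv_graph
  have hj := (P.hasDerivAt_j h.mem_dom).comp_hasFDerivAt p h.hasFDerivAt
  have hα := ((hasFDerivAt_snd.const_mul 2).mul hj).neg.mul hinv
  have hβ := hinv.const_mul 2
  refine ⟨hα.differentiableAt, hβ.differentiableAt, ?_⟩
  refine (DFunLike.congr_fun hα.fderiv _).trans ((DFunLike.congr_fun hβ.fderiv _).trans ?_).symm
  have hcompat := P.axialSqDeriv_compatibility (q := (p.1, Ψ p)) h.mem_dom
  rw [h.axialSq_eq] at hcompat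
  simp only [(P.hasFDerivAt_axialSqDeriv (q := (p.1, Ψ p)) h.mem_dom).fderiv,
    h.hasFDerivAt.fderiv, covector_apply, Pi.neg_apply, Pi.mul_apply, comp_apply, add_apply,
    neg_apply, smul_apply, ContinuousLinearMap.comp_apply, ContinuousLinearMap.prod_apply,
    ContinuousLinearMap.coe_fst', ContinuousLinearMap.coe_snd', smul_eq_mul, neg_smul, mul_one,
    mul_zero, add_zero, zero_add]
  field_simp
  linear_combination -P.axialSqDeriv (p.1, Ψ p) * hcompat

end IsHodographAt

theorem exists_axialCoordinate (hΨ : ∀ᶠ p in 𝓝 ((3 / 4, 0) : ℝ × ℝ), P.IsHodographAt Ψ p) :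
    ∃ Z : ℝ × ℝ → ℝ, Z (3 / 4, 0) = 0 ∧ ContDiffAt ℝ 1 Z (3 / 4, 0) ∧
      ∀ᶠ p in 𝓝 ((3 / 4, 0) : ℝ × ℝ), HasFDerivAt Z
        (covector (-(2 * p.2 * P.j (Ψ p)) * (P.axialSqDeriv (p.1, Ψ p))⁻¹)
          (2 * (P.axialSqDeriv (p.1, Ψ p))⁻¹)) p :=
  exists_local_primitive_covector (hΨ.mono fun _ h => h.axialCoordinate_closed.1)
    (hΨ.mono fun _ h => h.axialCoordinate_closed.2.1)
    (hΨ.mono fun _ h => h.axialCoordinate_closed.2.2)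

/-- `ψ` solves the stream function equation `∂ψ/∂ρ = ρ + k(ψ)` at `p = (ρ, z)`, and `v = ∂ψ/∂z` is
the square root of `axialSq` that is smooth across the minimum of `ψ`. -/
structure IsStreamFunctionAt (P : LevelProfile) (ψ v : ℝ × ℝ → ℝ) (p : ℝ × ℝ) : Prop where
  mem_dom : ψ p ∈ P.dom
  axialSq_eq : P.axialSq (p.1, ψ p) = v p ^ 2
  hasFDerivAt : HasFDerivAt ψ (covector (p.1 + P.k (ψ p)) (v p)) p
  hasFDerivAt_axial :
    HasFDerivAt v (covector (v p * P.j (ψ p)) (P.axialSqDeriv (p.1, ψ p) / 2)) p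

variable (P)

theorem exists_isStreamFunctionAt : ∃ ψ v : ℝ × ℝ → ℝ, ψ (3 / 4, 0) = 0 ∧
    ∀ᶠ p in 𝓝 ((3 / 4, 0) : ℝ × ℝ), P.IsStreamFunctionAt ψ v p ∧
      ((p.1, v p) = (3 / 4, 0) → p = (3 / 4, 0)) := by
  obtain ⟨Ψ, hΨ₀, hΨ⟩ := P.exists_hodograph
  obtain ⟨Z, hZ₀, hZsmooth, hZ⟩ := exists_axialCoordinate hΨ
  obtain ⟨v, hv₀, hgraph, himp⟩ := exists_implicit_plane (c := (3 / 4, 0)) (t₀ := 0) (φ := id)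
    hZsmooth contDiff_id hZ₀ <| by
      rw [hZ.self_of_nhds.fderiv]
      simp [covector_apply, hΨ₀, P.axialSqDeriv_center]
  refine ⟨fun p => Ψ (p.1, v p), v, by simp only [hv₀, hΨ₀], ?_⟩
  filter_upwards [himp, hgraph.eventually hΨ, hgraph.eventually hZ]
    with p ⟨hz, hderiv⟩ hΨp hZp
  have hD := hΨp.axialSqDeriv_pos.ne'
  have hv : HasFDerivAt v (covector (v p * P.j (Ψ (p.1, v p)))
      (P.axialSqDeriv (p.1, Ψ (p.1, v p)) / 2)) p := by
    convert hderiv _ _ hZp (by positivity) using 2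
    · field_simp
    · simp only [deriv_id]
      field_simp
  refine ⟨⟨hΨp.mem_dom, hΨp.axialSq_eq, ?_, hv⟩, fun hc => ?_⟩
  · refine (HasFDerivAt.comp (g := Ψ) p hΨp.hasFDerivAt (hasFDerivAt_fst.prodMk hv)).congr_fderiv
      (ContinuousLinearMap.ext fun y => ?_)
    simp only [covector_apply, ContinuousLinearMap.comp_apply, ContinuousLinearMap.prod_apply,
      ContinuousLinearMap.coe_fst']
    field_simp
    ring
  · rw [hc, hZ₀] at hz
    exact Prod.ext (congr_arg Prod.fst hc :) hz.symm

variable {P} in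
theorem pos_of_axialSq_eq {ρ v : ℝ} (hs : s ∈ P.dom) (hρ : 0 < ρ)
    (hpos : 0 < 1 + 2 * (ρ + P.k s) * P.j s) (hv : P.axialSq (ρ, s) = v ^ 2)
    (hne : (ρ, v) ≠ (3 / 4, 0)) : 0 < s := by
  have hkey : P.j s * (v ^ 2 + 2 * ρ * (ρ + P.k s) ^ 2) =
      3 * (1 + 2 * (ρ + P.k s) * P.j s) * s := by
    rw [← hv, axialSq]
    linear_combination -P.W_mul_j s hs
  have hj := P.j_pos s hs
  have hnonneg : 0 ≤ 3 * (1 + 2 * (ρ + P.k s) * P.j s) * s := by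
    rw [← hkey]
    positivity
  refine (nonneg_of_mul_nonneg_right hnonneg (by positivity)).lt_of_ne' fun hs₀ => hne ?_
  have hsum : v ^ 2 + 2 * ρ * (ρ + P.k s) ^ 2 = 0 := by
    simpa [hs₀, hj.ne', P.j_zero] using hkey
  have hv₀ : v ^ 2 = 0 := by nlinarith [sq_nonneg v, mul_nonneg hρ.le (sq_nonneg (ρ + P.k s))]
  have hρ₀ : ρ + P.k s = 0 := by simpa [hv₀, hρ.ne'] using hsum
  rw [hs₀, P.k_zero] at hρ₀
  exact Prod.ext (by linarith) (pow_eq_zero_iff two_ne_zero |>.1 hv₀)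

theorem exists_streamFunction : ∃ ψ v : ℝ × ℝ → ℝ, ψ (3 / 4, 0) = 0 ∧
    ∀ᶠ p in 𝓝 ((3 / 4, 0) : ℝ × ℝ), P.IsStreamFunctionAt ψ v p ∧ 0 < p.1 ∧
      (p ≠ (3 / 4, 0) → 0 < ψ p) := by
  obtain ⟨ψ, v, hψ₀, hψ⟩ := P.exists_isStreamFunctionAt
  have hψc : ContinuousAt ψ (3 / 4, 0) := hψ.self_of_nhds.1.hasFDerivAt.continuousAt
  have hk : ContinuousAt P.k (ψ (3 / 4, 0)) :=
    (P.hasDerivAt_k _ hψ.self_of_nhds.1.mem_dom).continuousAt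
  have hj : ContinuousAt P.j (ψ (3 / 4, 0)) :=
    (P.hasDerivAt_j hψ.self_of_nhds.1.mem_dom).continuousAt
  have hpos : ∀ᶠ p in 𝓝 ((3 / 4, 0) : ℝ × ℝ), 0 < 1 + 2 * (p.1 + P.k (ψ p)) * P.j (ψ p) := by
    have hcont : ContinuousAt (fun p => 1 + 2 * (p.1 + P.k (ψ p)) * P.j (ψ p)) (3 / 4, 0) :=
      continuousAt_const.add ((continuousAt_const.mul (continuousAt_fst.add (hk.comp hψc))).mul
        (hj.comp hψc))
    refine hcont.eventually (lt_mem_nhds ?_)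
    norm_num [hψ₀, P.k_zero]
  have hρ : ∀ᶠ p in 𝓝 ((3 / 4, 0) : ℝ × ℝ), 0 < p.1 :=
    continuousAt_fst.eventually (lt_mem_nhds (by norm_num))
  refine ⟨ψ, v, hψ₀, ?_⟩
  filter_upwards [hψ, hpos, hρ] with p ⟨hp, hinj⟩ hpos hρ
  exact ⟨hp, hρ, fun hne => pos_of_axialSq_eq hp.mem_dom hρ hpos hp.axialSq_eq fun h =>
    hne (hinj h)⟩

theorem contDiffOn_streamFunction {U : Set (ℝ × ℝ)} {ψ v : ℝ × ℝ → ℝ} (hU : IsOpen U)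
    (h : ∀ p ∈ U, P.IsStreamFunctionAt ψ v p) : ContDiffOn ℝ ∞ (fun p => (ψ p, v p)) U := by
  let S : Set ((ℝ × ℝ) × ℝ × ℝ) := {y | y.2.1 ∈ P.dom}
  let A (y : (ℝ × ℝ) × ℝ × ℝ) : ℝ × ℝ →L[ℝ] ℝ × ℝ := (covector (y.1.1 + P.k y.2.1) y.2.2).prod
    (covector (y.2.2 * P.j y.2.1) (P.axialSqDeriv (y.1.1, y.2.1) / 2))
  refine contDiffOn_of_hasFDerivAt_comp hU (A := A) (s := S) ?_ (fun p hp => (h p hp).mem_dom)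
    fun p hp => (h p hp).hasFDerivAt.prodMk (h p hp).hasFDerivAt_axial
  have hk : ContDiffOn ℝ ∞ (fun y : (ℝ × ℝ) × ℝ × ℝ => P.k y.2.1) S :=
    P.contDiffOn_k.comp (by fun_prop) fun y hy => hy
  have hj : ContDiffOn ℝ ∞ (fun y : (ℝ × ℝ) × ℝ × ℝ => P.j y.2.1) S :=
    P.contDiffOn_j.comp (by fun_prop) fun y hy => hy
  have hD : ContDiffOn ℝ ∞ (fun y : (ℝ × ℝ) × ℝ × ℝ => P.axialSqDeriv (y.1.1, y.2.1)) S :=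
    P.contDiffOn_axialSqDeriv.comp (f := fun y : (ℝ × ℝ) × ℝ × ℝ => (y.1.1, y.2.1))
      (by fun_prop) fun y hy => hy
  have hρ : ContDiffOn ℝ ∞ (fun y : (ℝ × ℝ) × ℝ × ℝ => y.1.1) S := by fun_prop
  have hv : ContDiffOn ℝ ∞ (fun y : (ℝ × ℝ) × ℝ × ℝ => y.2.2) S := by fun_prop
  exact (ContinuousLinearMap.prodₗᵢ ℝ).toContinuousLinearEquiv.contDiff.comp_contDiffOn
    ((contDiffOn_covector (hρ.add hk) hv).prodMk
      (contDiffOn_covector (hv.mul hj) (hD.div_const 2)))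

end LevelProfile

end Hodograph

theorem exists_isCompact_sublevel {E : Type*} [PseudoMetricSpace E] [ProperSpace E]
    {U : Set E} {c : E} {ψ : E → ℝ} (hU : U ∈ 𝓝 c) (hψ : ContinuousOn ψ U)
    (hc : ∀ p ∈ U, p ≠ c → ψ c < ψ p) :
    ∃ R > 0, ∃ μ > ψ c, Metric.ball c R ⊆ U ∧
      ∀ ε < μ, IsCompact {p ∈ Metric.ball c R | ψ p ≤ ε} := by
  obtain ⟨R, hR, hRU⟩ := Metric.nhds_basis_closedBall.mem_iff.1 hU
  have hsphere : Metric.sphere c R ⊆ U := Metric.sphere_subset_closedBall.trans hRU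
  obtain ⟨μ, hμ, hmin⟩ : ∃ μ > ψ c, ∀ p ∈ Metric.sphere c R, μ ≤ ψ p := by
    obtain hempty | hne := (Metric.sphere c R).eq_empty_or_nonempty
    · exact ⟨ψ c + 1, lt_add_one _, by simp [hempty]⟩
    obtain ⟨q, hq, hmin⟩ := (isCompact_sphere c R).exists_isMinOn hne (hψ.mono hsphere)
    exact ⟨ψ q, hc q (hsphere hq) (Metric.ne_of_mem_sphere hq hR.ne'), hmin⟩
  refine ⟨R, hR, μ, hμ, Metric.ball_subset_closedBall.trans hRU, fun ε hε => ?_⟩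
  have heq : {p ∈ Metric.ball c R | ψ p ≤ ε} = Metric.closedBall c R ∩ ψ ⁻¹' Iic ε := by
    refine Subset.antisymm (inter_subset_inter_left _ Metric.ball_subset_closedBall)
      fun p hp => ⟨(Metric.mem_closedBall.1 hp.1).lt_of_ne fun h => ?_, hp.2⟩
    exact ((hmin p h).trans hp.2).not_gt hε
  rw [heq]
  exact (isCompact_closedBall c R).of_isClosed_subset
    ((hψ.mono hRU).preimage_isClosed_of_isClosed Metric.isClosed_closedBall isClosed_Iic)
    inter_subset_left

section SwirlingFlow

theorem hasFDerivAt_mul_inv_two_fst {g : ℝ × ℝ → ℝ} {g' : ℝ × ℝ →L[ℝ] ℝ} {m : ℝ × ℝ}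
    (hg : HasFDerivAt g g' m) (hm : m.1 ≠ 0) : HasFDerivAt (fun m => g m * (2 * m.1)⁻¹)
      ((2 * m.1)⁻¹ • g' - covector (g m * (2 * m.1 ^ 2)⁻¹) 0) m := by
  have hfst := (hasFDerivAt_fst (𝕜 := ℝ) (E := ℝ) (F := ℝ) (p := m)).const_mul 2
  have hinv := (hasDerivAt_inv (mul_ne_zero two_ne_zero hm)).comp_hasFDerivAt m hfst
  refine (hg.mul hinv).congr_fderiv (ContinuousLinearMap.ext fun y => ?_)
  simp only [comp_apply, add_apply, smul_apply, sub_apply, covector_apply,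
    ContinuousLinearMap.coe_fst', smul_eq_mul, zero_mul, add_zero]
  field_simp
  ring

namespace LevelProfile

/-- The axisymmetric flow with stream function `ψ`, where `v = ∂ψ/∂z`, and with squared swirl
`P.W ∘ ψ`. -/
def flow (P : LevelProfile) (ψ v : ℝ × ℝ → ℝ) :
    EuclideanSpace ℝ (Fin 3) → EuclideanSpace ℝ (Fin 3) :=
  axisymmetricField (fun m => v m * (2 * m.1)⁻¹) (fun m => √(P.W (ψ m)) * (2 * m.1)⁻¹)
    (fun m => -(m.1 + P.k (ψ m)))

variable {P : LevelProfile} {ψ v : ℝ × ℝ → ℝ} {m : ℝ × ℝ} {x : EuclideanSpace ℝ (Fin 3)}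

theorem meridianField_flow (hm : m.1 ≠ 0) :
    meridianField (fun m => v m * (2 * m.1)⁻¹) (fun m => -(m.1 + P.k (ψ m))) m =
      (v m, -(m.1 + P.k (ψ m))) :=
  Prod.ext (by simp only [meridianField]; field_simp) rfl

namespace IsStreamFunctionAt

theorem fderiv_meridianField (h : P.IsStreamFunctionAt ψ v m) :
    fderiv ℝ ψ m (v m, -(m.1 + P.k (ψ m))) = 0 := by
  rw [h.hasFDerivAt.fderiv, covector_apply]
  ring

theorem fderiv_vertical_apply (h : P.IsStreamFunctionAt ψ v m) (y : ℝ × ℝ) :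
    fderiv ℝ (fun m => -(m.1 + P.k (ψ m))) m y = -(y.1 + P.j (ψ m) * fderiv ℝ ψ m y) := by
  have hk := (P.hasDerivAt_k _ h.mem_dom).comp_hasFDerivAt m
    h.hasFDerivAt.differentiableAt.hasFDerivAt
  exact DFunLike.congr_fun (hasFDerivAt_fst.add hk).neg.fderiv y

theorem divergence_flow (h : P.IsStreamFunctionAt ψ v m) (hm : m.1 ≠ 0) :
    2 * (v m * (2 * m.1)⁻¹) + 2 * m.1 * fderiv ℝ (fun m => v m * (2 * m.1)⁻¹) m (1, 0) +
      fderiv ℝ (fun m => -(m.1 + P.k (ψ m))) m (0, 1) = 0 := by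
  rw [(hasFDerivAt_mul_inv_two_fst h.hasFDerivAt_axial hm).fderiv, h.fderiv_vertical_apply,
    h.hasFDerivAt.fderiv]
  simp only [sub_apply, smul_apply, covector_apply, smul_eq_mul, mul_one, mul_zero, add_zero,
    zero_add]
  field_simp
  ring

theorem radial_momentum_flow (h : P.IsStreamFunctionAt ψ v m) (hm : m.1 ≠ 0) (hψ : 0 < ψ m) :
    fderiv ℝ (fun m => v m * (2 * m.1)⁻¹) m (v m, -(m.1 + P.k (ψ m))) +
      (v m * (2 * m.1)⁻¹) ^ 2 - (√(P.W (ψ m)) * (2 * m.1)⁻¹) ^ 2 + fderiv ℝ ψ m (1, 0) = 0 := by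
  have hbalance := P.j_mul_axialSq (q := (m.1, ψ m)) h.mem_dom
  have hv := h.axialSq_eq
  rw [hv] at hbalance
  rw [axialSq] at hv
  rw [(hasFDerivAt_mul_inv_two_fst h.hasFDerivAt_axial hm).fderiv, h.hasFDerivAt.fderiv, mul_pow,
    mul_pow, Real.sq_sqrt (P.W_pos h.mem_dom hψ).le]
  simp only [sub_apply, smul_apply, covector_apply, smul_eq_mul, zero_mul, add_zero, mul_one,
    mul_zero]
  field_simp
  linear_combination 2 * m.1 * hbalance + hv

theorem angular_momentum_flow (h : P.IsStreamFunctionAt ψ v m) (hm : m.1 ≠ 0) (hψ : 0 < ψ m) :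
    fderiv ℝ (fun m => √(P.W (ψ m)) * (2 * m.1)⁻¹) m (v m, -(m.1 + P.k (ψ m))) +
      2 * (v m * (2 * m.1)⁻¹) * (√(P.W (ψ m)) * (2 * m.1)⁻¹) = 0 := by
  have hswirl : HasFDerivAt (fun m => √(P.W (ψ m))) _ m :=
    ((P.hasDerivAt_W _ h.mem_dom).sqrt (P.W_pos h.mem_dom hψ).ne').comp_hasFDerivAt m
      h.hasFDerivAt.differentiableAt.hasFDerivAt
  rw [(hasFDerivAt_mul_inv_two_fst hswirl hm).fderiv, sub_apply, smul_apply, smul_apply,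
    h.fderiv_meridianField, covector_apply]
  field_simp
  ring

theorem axial_momentum_flow (h : P.IsStreamFunctionAt ψ v m) :
    fderiv ℝ (fun m => -(m.1 + P.k (ψ m))) m (v m, -(m.1 + P.k (ψ m))) +
      fderiv ℝ ψ m (0, 1) = 0 := by
  rw [h.fderiv_vertical_apply, h.fderiv_meridianField, h.hasFDerivAt.fderiv, covector_apply]
  ring

theorem fderiv_comp_meridian_flow (h : P.IsStreamFunctionAt ψ v (meridian x))
    (hx : (meridian x).1 ≠ 0) : fderiv ℝ (ψ ∘ meridian) x (P.flow ψ v x) = 0 := by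
  rw [(hasFDerivAt_comp_meridian h.hasFDerivAt.differentiableAt).fderiv,
    ContinuousLinearMap.comp_apply, flow, fderiv_meridian_axisymmetricField,
    meridianField_flow hx, h.fderiv_meridianField]

theorem flow_ne_zero (h : P.IsStreamFunctionAt ψ v (meridian x)) (hx : (meridian x).1 ≠ 0)
    (hψ : 0 < ψ (meridian x)) : P.flow ψ v x ≠ 0 := fun h₀ => hx <| by
  have hγ : √(P.W (ψ (meridian x))) * (2 * (meridian x).1)⁻¹ ≠ 0 :=
    mul_ne_zero (Real.sqrt_pos.2 (P.W_pos h.mem_dom hψ)).ne' (by positivity)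
  have hrot : √(P.W (ψ (meridian x))) * (2 * (meridian x).1)⁻¹ * (x 0 ^ 2 + x 1 ^ 2) =
      x 0 * P.flow ψ v x 1 - x 1 * P.flow ψ v x 0 := by
    simp only [flow, axisymmetricField, Matrix.cons_val_one, Matrix.cons_val_zero]
    ring
  have hxy : x 0 ^ 2 + x 1 ^ 2 = 0 := by
    refine (mul_eq_zero.1 ?_).resolve_left hγ
    rw [hrot, h₀]
    simp
  rw [meridian, hxy, zero_div]

end IsStreamFunctionAt

theorem isStationaryEulerAt_flow (h : ∀ᶠ m in 𝓝 (meridian x), P.IsStreamFunctionAt ψ v m)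
    (hm : (meridian x).1 ≠ 0) (hψ : 0 < ψ (meridian x)) :
    IsStationaryEulerAt (P.flow ψ v) (ψ ∘ meridian) x := by
  have hx := h.self_of_nhds
  have hdom := P.isOpen_dom.mem_nhds hx.mem_dom
  have hsmooth : ContDiffAt ℝ ∞ (fun m => (ψ m, v m)) (meridian x) := by
    obtain ⟨U, hUx, hU, hxU⟩ := eventually_nhds_iff.1 h
    exact (P.contDiffOn_streamFunction hU hUx).contDiffAt (hU.mem_nhds hxU)
  have hψs : ContDiffAt ℝ ∞ ψ (meridian x) := hsmooth.fst
  have hk : ContDiffAt ℝ ∞ (P.k ∘ ψ) (meridian x) := (P.contDiffOn_k.contDiffAt hdom).comp _ hψs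
  have hW : ContDiffAt ℝ ∞ (P.W ∘ ψ) (meridian x) := (P.contDiffOn_W.contDiffAt hdom).comp _ hψs
  have hinv : ContDiffAt ℝ ∞ (fun m : ℝ × ℝ => (2 * m.1)⁻¹) (meridian x) :=
    (contDiffAt_const.mul contDiffAt_fst).inv (mul_ne_zero two_ne_zero hm)
  refine isStationaryEulerAt_axisymmetricField (hsmooth.snd.mul hinv)
    ((hW.sqrt (P.W_pos hx.mem_dom hψ).ne').mul hinv) (contDiffAt_fst.add hk).neg hψs
    (hx.divergence_flow hm) ?_ ?_ ?_
  all_goals rw [meridianField_flow hm]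
  exacts [hx.radial_momentum_flow hm hψ, hx.angular_momentum_flow hm hψ, hx.axial_momentum_flow]

end LevelProfile

theorem meridian_surjOn : SurjOn meridian univ {m | 0 ≤ m.1} := fun m (hm : 0 ≤ m.1) =>
  ⟨!₂[√(2 * m.1), 0, m.2], mem_univ _, Prod.ext
    (show (√(2 * m.1) ^ 2 + 0 ^ 2) / 2 = m.1 by
      rw [Real.sq_sqrt (mul_nonneg zero_le_two hm)]
      ring) rfl⟩

theorem existsCompactEulerFlow_three : ExistsCompactEulerFlow 3 := by
  obtain ⟨P⟩ := nonempty_levelProfile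
  obtain ⟨ψ, v, hψ₀, hψ⟩ := P.exists_streamFunction
  obtain ⟨U, hUψ, hU, hcU⟩ := eventually_nhds_iff.1 hψ
  have hcont : ContinuousOn ψ U := fun m hm =>
    (hUψ m hm).1.hasFDerivAt.continuousAt.continuousWithinAt
  obtain ⟨R, hR, μ, hμ, hRU, hcompact⟩ := exists_isCompact_sublevel (hU.mem_nhds hcU) hcont
    fun m hm hne => hψ₀.trans_lt ((hUψ m hm).2.2 hne)
  have hnear : ∀ᶠ m in 𝓝 ((3 / 4, 0) : ℝ × ℝ), m ∈ Metric.ball (3 / 4, 0) R ∧ ψ m < μ :=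
    (eventually_mem_set.2 (Metric.ball_mem_nhds _ hR)).and
      ((hcont.continuousAt (hU.mem_nhds hcU)).eventually (gt_mem_nhds hμ))
  obtain ⟨m, ⟨hmR, hmμ⟩, hmne⟩ :=
    ((hnear.filter_mono nhdsWithin_le_nhds).and (self_mem_nhdsWithin (s := {(3 / 4, 0)}ᶜ))).exists
  obtain ⟨-, hρ, hpos⟩ := hUψ m (hRU hmR)
  obtain ⟨x, -, rfl⟩ := meridian_surjOn hρ.le
  have hψm := hpos hmne
  refine existsCompactEulerFlow_of_isCompact_sublevel (u := P.flow ψ v) (ψ := ψ ∘ meridian)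
    (a := ψ (meridian x) / 2) (b := (ψ (meridian x) + μ) / 2)
    (Metric.isOpen_ball.preimage contDiff_meridian.continuous)
    ((P.contDiffOn_streamFunction hU fun m hm => (hUψ m hm).1).fst.comp
      contDiff_meridian.contDiffOn fun y hy => hRU hy)
    (fun y hy hψy => ?_) (isCompact_preimage_meridian (hcompact _ (by linarith)))
    hmR ⟨half_lt_self hψm, by rw [comp_apply]; linarith⟩
    ((hUψ _ (hRU hmR)).1.flow_ne_zero hρ.ne' hψm)
  have hψy₀ : 0 < ψ (meridian y) := (half_pos hψm).trans hψy.1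
  have hy₀ := (hUψ _ (hRU hy)).2.1.ne'
  exact ⟨LevelProfile.isStationaryEulerAt_flow
    (hψ := hψy₀) (hm := hy₀) ((hU.eventually_mem (hRU hy)).mono fun m hm => (hUψ m hm).1),
    (hUψ _ (hRU hy)).1.fderiv_comp_meridian_flow hy₀⟩

end SwirlingFlow

end

theorem proposition2p1 :
    (∀ d : ℕ, (d = 3 ∨ (Even d ∧ 2 ≤ d)) →
      ∃ (u : EuclideanSpace ℝ (Fin d) → EuclideanSpace ℝ (Fin d))
        (p : EuclideanSpace ℝ (Fin d) → ℝ),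
        IsStationaryEuler u p ∧ HasCompactSupport u ∧ HasCompactSupport p ∧ u ≠ 0) ∧
    (∀ (d : ℕ) (hd : Even d), 2 ≤ d →
      ∀ f : ℝ → ℝ, ContDiff ℝ ∞ f → HasCompactSupport f → (∀ r, f (-r) = f r) →
        IsStationaryEuler (radialVelocity hd f) (radialPressure f) ∧
        HasCompactSupport (radialVelocity hd f) ∧
        (f ≠ 0 → radialVelocity hd f ≠ 0)) := by
  refine ⟨?_, fun d hd h2 f hf hc he => ⟨isStationaryEuler_radial hd hf he,
    hasCompactSupport_radialVelocity hd hc, radialVelocity_ne_zero hd h2 hf.continuous he⟩⟩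
  rintro d (rfl | ⟨hd, h2⟩)
  · exact existsCompactEulerFlow_three
  · exact existsCompactEulerFlow_of_even hd h2
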